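/- Let $\mathbf A(z)$ be an $M\times N$ complex matrix function that is analytic (holomorphic) in a neighbourhood of every point of the unit circle. (i) There are real-analytic functions on $\mathbb R$, possibly with negative values, one for each of the $\min(M,N)$ diagonal positions, whose absolute values at every $\Omega\in\mathbb R$ are the singular values of $\mathbf A(e^{j\Omega})$ with multiplicity. They can be chosen so that the distinct not identically zero ones among them, no two of which agree in absolute value, split into orbits $\nu=1,\dots,R$ of the following form: the orbit $\nu$ consists of $k_\nu\ge 1$ functions $\sigma_{\nu,1},\dots,\sigma_{\nu,k_\nu}$, each repeated on the diagonal with the same multiplicity $q_\nu\ge 1$, such that $\sigma_{\nu,i}(\Omega+2\pi)=\sigma_{\nu,i+1}(\Omega)$ for $1\le i<k_\nu$ and $\sigma_{\nu,k_\nu}(\Omega+2\pi)=(-1)^{\kappa_\nu-1}\sigma_{\nu,1}(\Omega)$, with $\kappa_\nu\in\{1,2\}$. The orbit is called $k_\nu$-multiplexed if $\kappa_\nu=1$ and signed $k_\nu$-multiplexed if $\kappa_\nu=2$. (ii) For every such choice and arrangement of analytic singular values there are an integer $L\ge1$ and matrices $\mathbf U(\Omega)$ ($M\times M$), $\mathbf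 S(\Omega)$ ($M\times N$), $\mathbf V(\Omega)$ ($N\times N$), obtained by the substitution $w=e^{j\Omega/L}$ from matrix functions of $w$ that are analytic on the unit circle, such that $$\mathbf A(e^{j\Omega})=\mathbf U(\Omega)\,\mathbf S(\Omega)\,\mathbf V(\Omega)^H\qquad\text{for all }\Omega\in\mathbb R,$$ where $\mathbf U,\mathbf V$ are paraunitary (as functions of $w$ they satisfy $\mathbf B(w)\,\mathbf B(1/\overline w)^H=\mathbf I$ near the unit circle), and $\mathbf S$ is diagonal with complex entries whose absolute values are the singular values of $\mathbf A(e^{j\Omega})$. The diagonal entry of $\mathbf S$ at each position of $\sigma_{\nu,i}$ is $$s_{\nu,i}(\Omega)=\sigma_{\nu,i}(\Omega)\,e^{j\Omega/(k_\nu\kappa_\nu)}\,\omega_{k_\nu\kappa_\nu}^{\,i-1},\qquad \omega_p=e^{2\pi j/p},$$ and the other diagonal entries are zero. Let $\mathbf U_{\nu,i}(\Omega)$ and $\mathbf V_{\nu,i}(\Omega)$ be the matrices of the $q_\nu$ columns of $\mathbf U(\Omega)$ and $\mathbf V(\Omega)$ at the positions of $\sigma_{\nu,i}$. Then, for every orbit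 $\nu$, signed or not, the entries $s_{\nu,i}$, the left singular vectors $\mathbf U_{\nu,i}$ and the right singular vectors $\mathbf V_{\nu,i}$ are all $k_\nu$-multiplexed without sign: a function $f_i$ of any of these three families satisfies $f_i(\Omega+2\pi)=f_{i+1}(\Omega)$ for $1\le i<k_\nu$ and $f_{k_\nu}(\Omega+2\pi)=f_1(\Omega)$. In particular all of them are $2\pi k_\nu$-periodic. -/

import Mathlib

noncomputable section

/-- Every entry of the matrix function `B` is analytic (holomorphic) in a neighbourhood of every
point of the unit circle. -/
def AnalyticOnCircle {m n : ℕ} (B : ℂ → Matrix (Fin m) (Fin n) ℂ) : Prop :=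
  ∀ a b, AnalyticOnNhd ℂ (fun z => B z a b) (Metric.sphere 0 1)

/-- The para-Hermitian operator `B^P(z) = B(1 / conj z)^H`. -/
def paraHermitian {m n : ℕ} (B : ℂ → Matrix (Fin m) (Fin n) ℂ) (z : ℂ) :
    Matrix (Fin n) (Fin m) ℂ :=
  (B (1 / starRingEnd ℂ z)).conjTranspose

/-- A square matrix function, analytic on the unit circle, is para-unitary if `B B^P = I` (in a
neighbourhood of the unit circle). -/
def IsParaunitary {m : ℕ} (B : ℂ → Matrix (Fin m) (Fin m) ℂ) : Prop :=
  AnalyticOnCircle B ∧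
    ∀ᶠ z in nhdsSet (Metric.sphere (0 : ℂ) 1), B z * paraHermitian B z = 1

/-- The function `B(Ω) = B(e^{jΩ/L})` of a real variable that represents the Puiseux matrix
`B(z^{1/L})`. -/
def onAngle {m n : ℕ} (L : ℕ) (B : ℂ → Matrix (Fin m) (Fin n) ℂ) (Ω : ℝ) :
    Matrix (Fin m) (Fin n) ℂ :=
  B (Complex.exp (Complex.I * Ω / L))

/-- The row (or left) index of the `l`-th diagonal position of an `M × N` matrix. -/
def diagRow {M N : ℕ} (l : Fin (min M N)) : Fin M := Fin.castLE (min_le_left M N) l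

/-- The column (or right) index of the `l`-th diagonal position of an `M × N` matrix. -/
def diagCol {M N : ℕ} (l : Fin (min M N)) : Fin N := Fin.castLE (min_le_right M N) l

/-- The multiset of the `min M N` singular values of a complex `M × N` matrix, repeated according
to multiplicity (zeros included). -/
def singularValueMultiset {M N : ℕ} (A : Matrix (Fin M) (Fin N) ℂ) : Multiset ℝ :=
  (Finset.univ : Finset (Fin (min M N))).val.map
    (fun l => (Matrix.toEuclideanLin A).singularValues (l : ℕ))

/-- The functions `f 0, …, f (k - 1)` are `k`-multiplexed: the shift by `2π` permutes them
cyclically, `f i (Ω + 2π) = f (i + 1) Ω`, the last one being sent to the first one. -/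
def IsMultiplexed {α : Type*} (k : ℕ) (f : Fin k → ℝ → α) : Prop :=
  ∀ (i : Fin k) (Ω : ℝ), f i (Ω + 2 * Real.pi) = f (finRotate k i) Ω

/-- The real functions `f 0, …, f (k - 1)` are `k`-multiplexed if `κ = 1`, and signed
`k`-multiplexed if `κ = 2`: the shift by `2π` permutes them cyclically, with a factor
`(-1) ^ (κ - 1)` when the last one is sent to the first one. -/
def IsSignedMultiplexed (κ k : ℕ) (f : Fin k → ℝ → ℝ) : Prop :=
  ∀ (i : Fin k) (Ω : ℝ), f i (Ω + 2 * Real.pi) =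
    (if (i : ℕ) + 1 < k then 1 else (-1) ^ (κ - 1)) * f (finRotate k i) Ω

/-- Analytic singular values of `Ω ↦ A (e^{jΩ})` (determined up to sign), together with their
arrangement into (signed) multiplexed orbits. -/
structure SingularValueOrbits {M N : ℕ} (A : ℂ → Matrix (Fin M) (Fin N) ℂ) where
  /-- The diagonal of `Σ(Ω)`: real analytic functions, possibly with negative values. -/
  diag : Fin (min M N) → ℝ → ℝ
  analytic : ∀ l, AnalyticOnNhd ℝ (diag l) Set.univ
  abs_diag : ∀ Ω : ℝ, (Finset.univ : Finset (Fin (min M N))).val.map (fun l => |diag l Ω|) =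
    singularValueMultiset (A (Complex.exp (Complex.I * Ω)))
  /-- The number of orbits. -/
  R : ℕ
  /-- The cardinality of each orbit. -/
  k : Fin R → ℕ
  k_pos : ∀ ν, 0 < k ν
  /-- The sign index of each orbit: `1` for multiplexed, `2` for signed multiplexed. -/
  κ : Fin R → ℕ
  κ_eq : ∀ ν, κ ν = 1 ∨ κ ν = 2
  /-- The common multiplicity of the singular values of each orbit. -/
  q : Fin R → ℕ
  q_pos : ∀ ν, 0 < q ν
  /-- The distinct nonzero singular values, as functions, listed orbit by orbit. -/
  σ : (ν : Fin R) → Fin (k ν) → ℝ → ℝ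
  /-- No two of them agree up to sign. -/
  σ_distinct : ∀ (x y : Σ ν : Fin R, Fin (k ν)),
    (∀ Ω, |σ x.1 x.2 Ω| = |σ y.1 y.2 Ω|) → x = y
  σ_ne_zero : ∀ ν i, ∃ Ω, σ ν i Ω ≠ 0
  /-- `pos ⟨ν, i, t⟩` is the diagonal position of the `t`-th copy of `σ ν i`. -/
  pos : (Σ ν : Fin R, Fin (k ν) × Fin (q ν)) ↪ Fin (min M N)
  diag_pos : ∀ ν i t, diag (pos ⟨ν, i, t⟩) = σ ν i
  diag_zero : ∀ l, l ∉ Set.range pos → ∀ Ω, diag l Ω = 0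
  multiplexed : ∀ ν, IsSignedMultiplexed (κ ν) (k ν) (σ ν)

/-- The `q ν` columns `U_i(Ω)` of `U(Ω)` that belong to the singular value `σ ν i`. -/
def SingularValueOrbits.leftVectors {M N : ℕ} {A : ℂ → Matrix (Fin M) (Fin N) ℂ}
    (D : SingularValueOrbits A) (U : ℝ → Matrix (Fin M) (Fin M) ℂ) (ν : Fin D.R)
    (i : Fin (D.k ν)) (Ω : ℝ) : Matrix (Fin M) (Fin (D.q ν)) ℂ :=
  Matrix.of fun a t => U Ω a (diagRow (D.pos ⟨ν, i, t⟩))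

/-- The `q ν` columns `V_i(Ω)` of `V(Ω)` that belong to the singular value `σ ν i`. -/
def SingularValueOrbits.rightVectors {M N : ℕ} {A : ℂ → Matrix (Fin M) (Fin N) ℂ}
    (D : SingularValueOrbits A) (V : ℝ → Matrix (Fin N) (Fin N) ℂ) (ν : Fin D.R)
    (i : Fin (D.k ν)) (Ω : ℝ) : Matrix (Fin N) (Fin (D.q ν)) ℂ :=
  Matrix.of fun b t => V Ω b (diagCol (D.pos ⟨ν, i, t⟩))

/-- The `l`-th diagonal entry of a rectangular matrix function. -/
def diagEntry {M N : ℕ} (S : ℝ → Matrix (Fin M) (Fin N) ℂ) (l : Fin (min M N)) (Ω : ℝ) : ℂ :=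
  S Ω (diagRow l) (diagCol l)

/-- The phase factor `e^{jΩ/p} ω_p^i`, where `ω_p = e^{2πj/p}` (and `i` is counted from `0`). -/
def phase (p i : ℕ) (Ω : ℝ) : ℂ :=
  Complex.exp (Complex.I * Ω / p) * Complex.exp (2 * Real.pi * Complex.I / p) ^ i

end

/-!
The singular values of `A (e^{iΩ})` are, up to zeros, the square roots of the eigenvalues of
`Aᴴ A`, so analytic singular values come from Rellich's theorem: a monic polynomial with real roots
whose coefficients are analytic functions of one real variable has analytic roots
(`exists_analytic_roots`, `exists_analytic_roots_global`). It is proved by induction on the degree.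
If two roots differ at the base point, the polynomial factors analytically
(`exists_analytic_factorization`, a consequence of the inverse function theorem). Otherwise the roots
are translated to have sum zero and divided by the power of `x - x₀` that makes the sum of their
squares nonzero at `x₀`; after that two of them differ. Local parametrizations agree up to a
permutation where they overlap, so they can be glued on `ℝ`. Applied to `X² - n`, the theorem gives
analytic square roots of nonnegative analytic functions (`exists_analytic_sqrt`). The shift by `2π`
permutes the finitely many distinct nonzero functions among the analytic squares of the singular
values, and its cycles are the orbits. A square root of one function of a cycle is shifted along the
cycle and returns up to sign (`nonempty_singularValueOrbits`).

For the factorization, let `σ` be the first function of an orbit of length `k`. It returns to `±σ`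
after `2πk`, and `s = σ e^{iΩ/(kκ)}` is `2πk`-periodic in both cases. Real-analytic functions of
period `T` form an integral domain (`analyticPeriodic`), so a singular matrix over this ring has a
null vector over the ring. Its norm has an analytic square root up to a phase factor that restores
periodicity, and division by it gives a null vector of norm one at every point, with the same period
(`exists_unit_null_vector`). Iteration yields orthonormal `2πk`-periodic bases of eigenvectors `v` of
`Aᴴ A` for the eigenvalue `σ²` (`exists_orthonormal_kernel`), and `u = A v / s` has only removable
singularities, since `‖A v‖ = |s|`. The vectors of the other members of the orbit are the shifts of
`v` and `u` by multiples of `2π`; with this choice the multiplexing property is the periodicity of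
`v`, `u` and `s`. Vectors of different singular values are orthogonal where these differ, hence
everywhere (`exists_singular_frames`).

Both orthonormal systems are completed to unitary matrices `U`, `V` over the ring of functions with
period `2πL`, `L` being the product of the orbit lengths (`exists_unitary_completion`), and
`S = Uᴴ A V`. The columns of `A V` that belong to the singular vectors exhaust the Frobenius norm of
`A`, so the others vanish and `S` has the required diagonal form. Finally, a `2πL`-periodic
real-analytic function is a function of `e^{iΩ/L}` that is holomorphic near the unit circle
(`exists_circle_extension`), and the identity theorem turns unitarity on the circle into
paraunitarity near it.
-/

open Filter Topology Polynomial
open scoped Matrix ComplexOrder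

/-! ### Polynomials with analytic coefficients and Hensel's lemma -/

/-- A family of polynomials, parametrized by a real normed space, all of whose coefficients are
real-analytic functions of the parameter at `x`. -/
def AnalyticCoeffsAt {E R : Type*} [NormedAddCommGroup E] [NormedSpace ℝ E] [NormedCommRing R]
    [NormedAlgebra ℝ R] (P : E → R[X]) (x : E) : Prop :=
  ∀ k, AnalyticAt ℝ (fun y => (P y).coeff k) x

namespace AnalyticCoeffsAt

variable {E R : Type*} [NormedAddCommGroup E] [NormedSpace ℝ E] [NormedCommRing R]
  [NormedAlgebra ℝ R] {P Q : E → R[X]} {x : E}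

lemma const (p : R[X]) : AnalyticCoeffsAt (fun _ : E => p) x := fun _ => analyticAt_const

lemma C {f : E → R} (hf : AnalyticAt ℝ f x) : AnalyticCoeffsAt (fun y => Polynomial.C (f y)) x := by
  intro k
  rcases eq_or_ne k 0 with rfl | hk
  · simpa using hf
  · simpa [coeff_C_of_ne_zero hk] using analyticAt_const

lemma add (hP : AnalyticCoeffsAt P x) (hQ : AnalyticCoeffsAt Q x) :
    AnalyticCoeffsAt (fun y => P y + Q y) x := fun k => by
  simpa using (hP k).fun_add (hQ k)

lemma sub (hP : AnalyticCoeffsAt P x) (hQ : AnalyticCoeffsAt Q x) :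
    AnalyticCoeffsAt (fun y => P y - Q y) x := fun k => by
  simpa using (hP k).fun_sub (hQ k)

lemma mul (hP : AnalyticCoeffsAt P x) (hQ : AnalyticCoeffsAt Q x) :
    AnalyticCoeffsAt (fun y => P y * Q y) x := fun k => by
  simp only [coeff_mul]
  exact Finset.analyticAt_fun_sum _ fun p _ => (hP p.1).fun_mul (hQ p.2)

lemma pow (hP : AnalyticCoeffsAt P x) (n : ℕ) : AnalyticCoeffsAt (fun y => P y ^ n) x := by
  induction n with
  | zero => simpa using const 1
  | succ n ih => simpa [pow_succ] using ih.mul hP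

lemma sum {ι : Type*} (s : Finset ι) {P : ι → E → R[X]} (h : ∀ i ∈ s, AnalyticCoeffsAt (P i) x) :
    AnalyticCoeffsAt (fun y => ∑ i ∈ s, P i y) x := fun k => by
  simp only [finsetSum_coeff]
  exact Finset.analyticAt_fun_sum _ fun i hi => h i hi k

lemma prod {ι : Type*} (s : Finset ι) {P : ι → E → R[X]} (h : ∀ i ∈ s, AnalyticCoeffsAt (P i) x) :
    AnalyticCoeffsAt (fun y => ∏ i ∈ s, P i y) x := by
  classical
  induction s using Finset.induction_on with
  | empty => simpa using const 1
  | insert a s ha ih =>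
    simp only [Finset.prod_insert ha]
    exact (h a (by simp)).mul (ih fun i hi => h i (by simp [hi]))

lemma congr (hP : AnalyticCoeffsAt P x) (h : P =ᶠ[𝓝 x] Q) : AnalyticCoeffsAt Q x := fun k =>
  (hP k).congr (h.mono fun y hy => by simp [hy])

lemma X_sub_C {f : E → R} (hf : AnalyticAt ℝ f x) :
    AnalyticCoeffsAt (fun y => X - Polynomial.C (f y)) x := (const X).sub (C hf)

lemma comp (hP : AnalyticCoeffsAt P x) {d : ℕ} (hd : ∀ᶠ y in 𝓝 x, (P y).natDegree = d)
    (hQ : AnalyticCoeffsAt Q x) : AnalyticCoeffsAt (fun y => (P y).comp (Q y)) x := by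
  refine congr (P := fun y => ∑ i ∈ Finset.range (d + 1),
    Polynomial.C ((P y).coeff i) * Q y ^ i) ?_ ?_
  · exact sum _ fun i _ => (C (hP i)).mul (hQ.pow i)
  · filter_upwards [hd] with y hy
    rw [comp_eq_sum_left, sum_over_range' (P y) (by simp) (d + 1) (by omega)]

end AnalyticCoeffsAt

/-- The monic polynomial of degree `a` with lower coefficients `u`. -/
noncomputable def monicPoly (a : ℕ) (u : Fin a → ℝ) : ℝ[X] := X ^ a + ∑ i, C (u i) * X ^ (i : ℕ)

lemma degree_sum_lt (a : ℕ) (u : Fin a → ℝ) : (∑ i, C (u i) * X ^ (i : ℕ) : ℝ[X]).degree < a := by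
  rcases Nat.eq_zero_or_pos a with rfl | ha
  · simp [bot_lt_iff_ne_bot]
  refine lt_of_le_of_lt (degree_sum_le _ _) ((Finset.sup_lt_iff (by simp [bot_lt_iff_ne_bot])).2 ?_)
  intro i _
  exact (degree_C_mul_X_pow_le _ _).trans_lt (by exact_mod_cast i.2)

lemma coeff_sum_fin (a : ℕ) (u : Fin a → ℝ) (i : Fin a) :
    (∑ i, C (u i) * X ^ (i : ℕ) : ℝ[X]).coeff i = u i := by
  simp [coeff_X_pow, Fin.val_inj]

lemma monicPoly_monic (a : ℕ) (u : Fin a → ℝ) : (monicPoly a u).Monic :=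
  monic_X_pow_add (degree_sum_lt a u)

lemma monicPoly_natDegree (a : ℕ) (u : Fin a → ℝ) : (monicPoly a u).natDegree = a := by
  have : (monicPoly a u).degree = a := by
    unfold monicPoly
    rw [degree_add_eq_left_of_degree_lt] <;> simp [degree_sum_lt]
  exact natDegree_eq_of_degree_eq_some this

lemma eq_monicPoly {a : ℕ} {p : ℝ[X]} (hp : p.Monic) (hd : p.natDegree = a) :
    p = monicPoly a (fun i => p.coeff i) := by
  subst hd
  conv_lhs => rw [hp.as_sum]
  rw [monicPoly, Finset.sum_range]

lemma monicPoly_analytic (a : ℕ) (u : Fin a → ℝ) : AnalyticCoeffsAt (monicPoly a) u := by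
  refine (AnalyticCoeffsAt.const _).add (AnalyticCoeffsAt.sum _ fun i _ =>
    (AnalyticCoeffsAt.C ?_).mul (AnalyticCoeffsAt.const _))
  exact (ContinuousLinearMap.proj (R := ℝ) (φ := fun _ : Fin a => ℝ) i).analyticAt u

/-- Multiplication of monic polynomials of degrees `a` and `b`, in terms of the lower
coefficients. -/
noncomputable def mulCoeffs (a b : ℕ) (w : (Fin a → ℝ) × (Fin b → ℝ)) : Fin (a + b) → ℝ :=
  fun j => (monicPoly a w.1 * monicPoly b w.2).coeff j

lemma mulCoeffs_analyticAt (a b : ℕ) (w : (Fin a → ℝ) × (Fin b → ℝ)) :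
    AnalyticAt ℝ (mulCoeffs a b) w := by
  rw [analyticAt_pi_iff]
  intro j
  refine AnalyticCoeffsAt.mul (P := fun w : (Fin a → ℝ) × (Fin b → ℝ) => monicPoly a w.1)
    (Q := fun w => monicPoly b w.2) ?_ ?_ _
  · exact fun k => (monicPoly_analytic a w.1 k).comp_of_eq analyticAt_fst rfl
  · exact fun k => (monicPoly_analytic b w.2 k).comp_of_eq analyticAt_snd rfl

lemma eq_mul_of_mulCoeffs {a b : ℕ} {p : ℝ[X]} (hp : p.Monic) (hd : p.natDegree = a + b)
    {w : (Fin a → ℝ) × (Fin b → ℝ)} (h : mulCoeffs a b w = fun j : Fin (a + b) => p.coeff j) :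
    p = monicPoly a w.1 * monicPoly b w.2 := by
  have hm := (monicPoly_monic a w.1).mul (monicPoly_monic b w.2)
  have hn : (monicPoly a w.1 * monicPoly b w.2).natDegree = a + b := by
    rw [(monicPoly_monic a w.1).natDegree_mul (monicPoly_monic b w.2)]
    simp [monicPoly_natDegree]
  rw [eq_monicPoly hp hd, eq_monicPoly hm hn]
  exact congrArg _ h.symm

/-- The derivative of the multiplication map in the direction `(h, k)` is `h q + p k`. -/
lemma fderiv_mulCoeffs (a b : ℕ) (w z : (Fin a → ℝ) × (Fin b → ℝ)) (j : Fin (a + b)) :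
    fderiv ℝ (mulCoeffs a b) w z j =
      ((∑ i, C (z.1 i) * X ^ (i : ℕ)) * monicPoly b w.2 +
        monicPoly a w.1 * ∑ i, C (z.2 i) * X ^ (i : ℕ)).coeff j := by
  set H : ℝ[X] := ∑ i, C (z.1 i) * X ^ (i : ℕ)
  set K : ℝ[X] := ∑ i, C (z.2 i) * X ^ (i : ℕ)
  have h1 : HasDerivAt (fun t : ℝ => mulCoeffs a b (w + t • z))
      (fderiv ℝ (mulCoeffs a b) w z) 0 := by
    have h0 : HasFDerivAt (mulCoeffs a b) (fderiv ℝ (mulCoeffs a b) w) (w + (0 : ℝ) • z) := by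
      simpa using (mulCoeffs_analyticAt a b w).differentiableAt.hasFDerivAt
    have hl : HasDerivAt (fun t : ℝ => w + t • z) z 0 := by
      simpa using ((hasDerivAt_id (0 : ℝ)).smul_const z).const_add w
    exact HasFDerivAt.comp_hasDerivAt (f := fun t : ℝ => w + t • z) (0 : ℝ) h0 hl
  have h2 := hasDerivAt_pi.1 h1 j
  have h3 : (fun t : ℝ => mulCoeffs a b (w + t • z) j) = fun t =>
      (monicPoly a w.1 * monicPoly b w.2).coeff j + t * (H * monicPoly b w.2 +
        monicPoly a w.1 * K).coeff j + t ^ 2 * (H * K).coeff j := by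
    funext t
    have e1 : monicPoly a (w + t • z).1 = monicPoly a w.1 + C t * H := by
      simp [monicPoly, H, Finset.mul_sum, Finset.sum_add_distrib, add_mul, add_assoc, mul_assoc]
    have e2 : monicPoly b (w + t • z).2 = monicPoly b w.2 + C t * K := by
      simp [monicPoly, K, Finset.mul_sum, Finset.sum_add_distrib, add_mul, add_assoc, mul_assoc]
    have e3 : (monicPoly a w.1 + C t * H) * (monicPoly b w.2 + C t * K) =
        monicPoly a w.1 * monicPoly b w.2 + C t * (H * monicPoly b w.2 + monicPoly a w.1 * K) +
          C (t ^ 2) * (H * K) := by rw [C_pow]; ring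
    rw [mulCoeffs, e1, e2, e3]
    simp only [coeff_add, coeff_C_mul]
  rw [h3] at h2
  refine h2.unique ?_
  have h4 := (((hasDerivAt_id (0 : ℝ)).mul_const ((H * monicPoly b w.2 +
        monicPoly a w.1 * K).coeff j)).const_add ((monicPoly a w.1 * monicPoly b w.2).coeff j)).fun_add
      (((hasDerivAt_id (0 : ℝ)).pow 2).mul_const ((H * K).coeff j))
  simpa using h4

lemma fderiv_mulCoeffs_injective {a b : ℕ} {w : (Fin a → ℝ) × (Fin b → ℝ)}
    (hc : IsCoprime (monicPoly a w.1) (monicPoly b w.2)) :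
    Function.Injective (fderiv ℝ (mulCoeffs a b) w) := by
  rw [injective_iff_map_eq_zero]
  intro z hz
  set H : ℝ[X] := ∑ i, C (z.1 i) * X ^ (i : ℕ) with hH
  set K : ℝ[X] := ∑ i, C (z.2 i) * X ^ (i : ℕ) with hK
  have da : (monicPoly a w.1).degree = a := by
    rw [degree_eq_natDegree (monicPoly_monic a w.1).ne_zero, monicPoly_natDegree]
  have db : (monicPoly b w.2).degree = b := by
    rw [degree_eq_natDegree (monicPoly_monic b w.2).ne_zero, monicPoly_natDegree]
  have hs : H * monicPoly b w.2 + monicPoly a w.1 * K = 0 := by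
    have hdeg : (H * monicPoly b w.2 + monicPoly a w.1 * K).degree < (a + b : ℕ) := by
      refine (degree_add_le _ _).trans_lt (max_lt ?_ ?_)
      · rw [degree_mul, db]
        push_cast
        exact WithBot.add_lt_add_right (by simp) (degree_sum_lt a z.1)
      · rw [degree_mul, da]
        push_cast
        exact WithBot.add_lt_add_left (by simp) (degree_sum_lt b z.2)
    ext j
    by_cases hj : j < a + b
    · have := fderiv_mulCoeffs a b w z ⟨j, hj⟩
      rw [hz] at this
      simpa using this.symm
    · rw [coeff_zero]
      exact coeff_eq_zero_of_degree_lt (hdeg.trans_le (by exact_mod_cast not_lt.1 hj))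
  have hH0 : H = 0 := by
    have hdvd : monicPoly a w.1 ∣ H * monicPoly b w.2 :=
      ⟨-K, by rw [mul_neg]; exact eq_neg_of_add_eq_zero_left hs⟩
    refine eq_zero_of_dvd_of_degree_lt (hc.dvd_of_dvd_mul_right hdvd) ?_
    rw [da]
    exact degree_sum_lt a z.1
  have hK0 : K = 0 := by
    rw [hH0, zero_mul, zero_add] at hs
    exact (mul_eq_zero.1 hs).resolve_left (monicPoly_monic a w.1).ne_zero
  refine Prod.ext (funext fun i => ?_) (funext fun i => ?_)
  · rw [← coeff_sum_fin a z.1 i, ← hH, hH0]; simp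
  · rw [← coeff_sum_fin b z.2 i, ← hK, hK0]; simp

/-- Hensel's lemma for analytic families: a coprime factorization of the polynomial at one point
extends to a factorization with analytic coefficients nearby. The factors are found by the
inverse function theorem, the derivative of polynomial multiplication at a coprime pair being
bijective. -/
theorem exists_analytic_factorization {P : ℝ → ℝ[X]} {x₀ : ℝ} {a b : ℕ}
    (hP : AnalyticCoeffsAt P x₀)
    (hm : ∀ᶠ x in 𝓝 x₀, (P x).Monic ∧ (P x).natDegree = a + b) {p q : ℝ[X]} (hp : p.Monic)
    (hq : q.Monic) (hpa : p.natDegree = a) (hqb : q.natDegree = b) (hc : IsCoprime p q)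
    (h₀ : P x₀ = p * q) :
    ∃ F G : ℝ → ℝ[X], AnalyticCoeffsAt F x₀ ∧ AnalyticCoeffsAt G x₀ ∧
      (∀ x, (F x).Monic ∧ (F x).natDegree = a) ∧ (∀ x, (G x).Monic ∧ (G x).natDegree = b) ∧
      ∀ᶠ x in 𝓝 x₀, P x = F x * G x := by
  set w : (Fin a → ℝ) × (Fin b → ℝ) := (fun i => p.coeff i, fun i => q.coeff i)
  have hpw : p = monicPoly a w.1 := eq_monicPoly hp hpa
  have hqw : q = monicPoly b w.2 := eq_monicPoly hq hqb
  have hinj : Function.Injective (fderiv ℝ (mulCoeffs a b) w) :=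
    fderiv_mulCoeffs_injective (by rwa [← hpw, ← hqw])
  let e : ((Fin a → ℝ) × (Fin b → ℝ)) ≃L[ℝ] (Fin (a + b) → ℝ) :=
    (LinearMap.linearEquivOfInjective (fderiv ℝ (mulCoeffs a b) w).toLinearMap hinj
      (by simp)).toContinuousLinearEquiv
  have he : (e : ((Fin a → ℝ) × (Fin b → ℝ)) →L[ℝ] (Fin (a + b) → ℝ)) =
      fderiv ℝ (mulCoeffs a b) w := by
    exact ContinuousLinearMap.ext fun z => rfl
  have han := mulCoeffs_analyticAt a b w
  have hcd : ContDiffAt ℝ ⊤ (mulCoeffs a b) w := han.contDiffAt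
  have hfd : HasFDerivAt (mulCoeffs a b) (e : _ →L[ℝ] _) w := by
    rw [he]; exact han.differentiableAt.hasFDerivAt
  have hinv : AnalyticAt ℝ (hcd.localInverse hfd (by simp)) (mulCoeffs a b w) :=
    (hcd.to_localInverse hfd (by simp)).analyticAt
  have hri : ∀ᶠ y in 𝓝 (mulCoeffs a b w),
      mulCoeffs a b (hcd.localInverse hfd (by simp) y) = y :=
    (hcd.hasStrictFDerivAt' hfd (by simp)).eventually_right_inverse
  set ψ := hcd.localInverse hfd (by simp)
  have hc0 : AnalyticAt ℝ (fun x => fun j : Fin (a + b) => (P x).coeff j) x₀ :=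
    analyticAt_pi_iff.2 fun j => hP j
  have hval : (fun j : Fin (a + b) => (P x₀).coeff j) = mulCoeffs a b w := by
    funext j; rw [h₀, mulCoeffs, ← hpw, ← hqw]
  have hcomp : AnalyticAt ℝ (fun x => ψ (fun j : Fin (a + b) => (P x).coeff j)) x₀ :=
    hinv.comp_of_eq hc0 hval
  refine ⟨fun x => monicPoly a (ψ fun j => (P x).coeff j).1,
    fun x => monicPoly b (ψ fun j => (P x).coeff j).2, fun k => ?_, fun k => ?_,
    fun x => ⟨monicPoly_monic _ _, monicPoly_natDegree _ _⟩,
    fun x => ⟨monicPoly_monic _ _, monicPoly_natDegree _ _⟩, ?_⟩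
  · exact (monicPoly_analytic a _ k).comp (f := fun x => (ψ fun j => (P x).coeff j).1)
      (analyticAt_fst.comp hcomp)
  · exact (monicPoly_analytic b _ k).comp (f := fun x => (ψ fun j => (P x).coeff j).2)
      (analyticAt_snd.comp hcomp)
  · have hev := (hc0.continuousAt.tendsto.eventually (by rw [hval]; exact hri))
    filter_upwards [hev, hm] with x hx hmx
    exact eq_mul_of_mulCoeffs hmx.1 hmx.2 hx

/-! ### Polynomials with real roots -/

/-- The monic real polynomial with the roots `r i`. -/
noncomputable def rootPoly {d : ℕ} (r : Fin d → ℝ) : ℝ[X] := ∏ i, (X - C (r i))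

lemma rootPoly_monic {d : ℕ} (r : Fin d → ℝ) : (rootPoly r).Monic :=
  monic_prod_of_monic _ _ fun _ _ => monic_X_sub_C _

lemma rootPoly_natDegree {d : ℕ} (r : Fin d → ℝ) : (rootPoly r).natDegree = d := by
  rw [rootPoly, natDegree_prod_of_monic _ _ fun _ _ => monic_X_sub_C _]; simp

lemma rootPoly_ne_zero {d : ℕ} (r : Fin d → ℝ) : rootPoly r ≠ 0 := (rootPoly_monic r).ne_zero

lemma roots_rootPoly {d : ℕ} (r : Fin d → ℝ) :
    (rootPoly r).roots = (Finset.univ : Finset (Fin d)).val.map r := by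
  have : rootPoly r = (((Finset.univ : Finset (Fin d)).val.map r).map fun a => X - C a).prod := by
    rw [Multiset.map_map]; rfl
  rw [this, roots_multiset_prod_X_sub_C]

lemma rootPoly_splits {d : ℕ} (r : Fin d → ℝ) : (rootPoly r).Splits :=
  Splits.prod fun _ _ => Splits.X_sub_C _

lemma exists_eq_rootPoly {d : ℕ} {p : ℝ[X]} (hp : p.Monic) (hd : p.natDegree = d)
    (hs : p.Splits) : ∃ r : Fin d → ℝ, p = rootPoly r := by
  have h1 := hs.eq_prod_roots_of_monic hp
  have h2 : p.roots.card = d := by rw [← hd, hs.natDegree_eq_card_roots]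
  obtain ⟨l, hl⟩ := Quot.exists_rep p.roots
  change (l : Multiset ℝ) = p.roots at hl
  rw [← hl] at h1 h2
  rw [Multiset.coe_card] at h2
  subst h2
  refine ⟨l.get, ?_⟩
  rw [h1, rootPoly, ← List.prod_ofFn, Multiset.map_coe, Multiset.prod_coe]
  congr 1
  conv_lhs => rw [← List.ofFn_get l, List.map_ofFn]
  rfl

lemma rootPoly_append {a b : ℕ} (r : Fin a → ℝ) (s : Fin b → ℝ) :
    rootPoly (Fin.append r s) = rootPoly r * rootPoly s := by
  simp [rootPoly, Fin.prod_univ_add]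

lemma rootPoly_analytic {E : Type*} [NormedAddCommGroup E] [NormedSpace ℝ E] {d : ℕ}
    {r : E → Fin d → ℝ} {x : E} (h : ∀ i, AnalyticAt ℝ (fun y => r y i) x) :
    AnalyticCoeffsAt (fun y => rootPoly (r y)) x :=
  AnalyticCoeffsAt.prod _ fun i _ => AnalyticCoeffsAt.X_sub_C (h i)

lemma rootPoly_coeff_continuous {d : ℕ} (k : ℕ) :
    Continuous fun r : Fin d → ℝ => (rootPoly r).coeff k := by
  rw [continuous_iff_continuousAt]
  intro r
  refine (rootPoly_analytic (r := fun r => r) (fun i => ?_) k).continuousAt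
  exact (ContinuousLinearMap.proj (R := ℝ) (φ := fun _ : Fin d => ℝ) i).analyticAt r

lemma rootPoly_coeff_pred {d : ℕ} (hd : 0 < d) (r : Fin d → ℝ) :
    (rootPoly r).coeff (d - 1) = -∑ i, r i := by
  simpa [rootPoly] using prod_X_sub_C_coeff_card_pred (Finset.univ : Finset (Fin d)) r (by simpa)

lemma rootPoly_comp_X_add_C {d : ℕ} (r : Fin d → ℝ) (c : ℝ) :
    (rootPoly r).comp (X + C c) = rootPoly fun i => r i - c := by
  simp only [rootPoly, prod_comp]
  refine Finset.prod_congr rfl fun i _ => ?_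
  simp only [sub_comp, X_comp, C_comp, C_sub]
  ring

lemma rootPoly_smul_coeff {d : ℕ} (r : Fin d → ℝ) {c : ℝ} (hc : c ≠ 0) {k : ℕ} (hk : k ≤ d) :
    (rootPoly fun i => c * r i).coeff k = c ^ (d - k) * (rootPoly r).coeff k := by
  have h : (rootPoly fun i => c * r i).comp (C c * X) = C (c ^ d) * rootPoly r := by
    have e : ∀ i, (X - C (c * r i)).comp (C c * X) = C c * (X - C (r i)) := fun i => by
      rw [sub_comp, X_comp, C_comp, C_mul]; ring
    simp only [rootPoly, prod_comp, e, Finset.prod_mul_distrib, Finset.prod_const, C_pow]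
    simp
  have h2 := congrArg (fun p => coeff p k) h
  simp only [comp_C_mul_X_coeff, coeff_C_mul] at h2
  have h3 : c ^ d = c ^ (d - k) * c ^ k := by rw [← pow_add]; congr 1; omega
  rw [h3] at h2
  apply mul_right_cancel₀ (pow_ne_zero k hc)
  rw [h2]; ring

/-- The sum of the squares of the roots is read off from `∏ (X - r i) (X + r i)`, so it is
analytic as soon as the elementary symmetric functions are. -/
lemma sum_sq_eq_coeff {d : ℕ} (hd : 0 < d) (r : Fin d → ℝ) :
    ∑ i, r i ^ 2 =
      -(rootPoly r * (C ((-1) ^ d) * (rootPoly r).comp (-X))).coeff ((d - 1) * 2) := by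
  have h : rootPoly r * (C ((-1) ^ d) * (rootPoly r).comp (-X)) =
      expand ℝ 2 (rootPoly fun i => r i ^ 2) := by
    have e : (C ((-1) ^ d) : ℝ[X]) = ∏ _i : Fin d, C (-1) := by simp
    rw [e]
    simp only [rootPoly, prod_comp, map_prod, ← Finset.prod_mul_distrib]
    refine Finset.prod_congr rfl fun i _ => ?_
    rw [map_sub, expand_X, expand_C, sub_comp, X_comp, C_comp, C_pow, C_neg, C_1]
    ring
  rw [h, coeff_expand_mul (by norm_num), rootPoly_coeff_pred hd, neg_neg]

lemma sum_sq_analyticAt {d : ℕ} (hd : 0 < d) {r : ℝ → Fin d → ℝ} {x : ℝ}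
    (h : AnalyticCoeffsAt (fun y => rootPoly (r y)) x) :
    AnalyticAt ℝ (fun y => ∑ i, r y i ^ 2) x := by
  simp only [sum_sq_eq_coeff hd]
  refine (AnalyticCoeffsAt.mul h (AnalyticCoeffsAt.mul (AnalyticCoeffsAt.const _)
    (AnalyticCoeffsAt.comp h (d := d) ?_ (AnalyticCoeffsAt.const (-X)))) _).fun_neg
  exact Eventually.of_forall fun y => rootPoly_natDegree _

lemma eq_rootPoly_of_coeff {d : ℕ} {r s : Fin d → ℝ}
    (h : ∀ j < d, (rootPoly r).coeff j = (rootPoly s).coeff j) : rootPoly r = rootPoly s := by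
  rw [eq_monicPoly (rootPoly_monic r) (rootPoly_natDegree r),
    eq_monicPoly (rootPoly_monic s) (rootPoly_natDegree s)]
  congr 1
  funext j
  exact h j j.2

/-- Monic polynomials with real roots in a bounded set have limits with real roots. -/
lemma exists_rootPoly_of_tendsto {α : Type*} {l : Filter α} [l.NeBot] {d : ℕ}
    {ρ : α → Fin d → ℝ} {B : ℝ} (hB : ∀ᶠ a in l, ∀ i, |ρ a i| ≤ B) {c : Fin d → ℝ}
    (hc : ∀ j, Tendsto (fun a => (rootPoly (ρ a)).coeff (j : Fin d)) l (𝓝 (c j))) :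
    ∃ r : Fin d → ℝ, ∀ j : Fin d, (rootPoly r).coeff j = c j := by
  set K : Set (Fin d → ℝ) := Set.pi Set.univ fun _ => Set.Icc (-B) B
  have hK : IsCompact K := isCompact_univ_pi fun _ => isCompact_Icc
  set Φ : (Fin d → ℝ) → (Fin d → ℝ) := fun r j => (rootPoly r).coeff j
  have hΦ : Continuous Φ := continuous_pi fun j => rootPoly_coeff_continuous _
  have hcl : IsClosed (Φ '' K) := (hK.image hΦ).isClosed
  have hmem : c ∈ Φ '' K := by
    refine hcl.mem_of_tendsto (f := fun a => Φ (ρ a)) (tendsto_pi_nhds.2 hc) ?_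
    filter_upwards [hB] with a ha
    exact ⟨ρ a, fun i _ => abs_le.1 (ha i), rfl⟩
  obtain ⟨r, -, hr⟩ := hmem
  exact ⟨r, fun j => congrFun hr j⟩

lemma exists_coeff_bound {d : ℕ} (B : ℝ) (j : ℕ) :
    ∃ D : ℝ, ∀ r : Fin d → ℝ, (∀ i, |r i| ≤ B) → |(rootPoly r).coeff j| ≤ D := by
  have hK : IsCompact (Set.pi Set.univ fun _ : Fin d => Set.Icc (-B) B) :=
    isCompact_univ_pi fun _ => isCompact_Icc
  obtain ⟨D, hD⟩ := hK.exists_bound_of_continuousOn (rootPoly_coeff_continuous j).continuousOn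
  exact ⟨D, fun r hr => hD r fun i _ => abs_le.1 (hr i)⟩

/-- An analytic function that is `O((x - x₀) ^ n)` is divisible by `(x - x₀) ^ n`. -/
lemma exists_eq_pow_smul_of_norm_le {E : Type*} [NormedAddCommGroup E] [NormedSpace ℝ E]
    {f : ℝ → E} {x₀ D : ℝ} {n : ℕ} (hf : AnalyticAt ℝ f x₀)
    (h : ∀ᶠ x in 𝓝[≠] x₀, ‖f x‖ ≤ D * |x - x₀| ^ n) :
    ∃ g : ℝ → E, AnalyticAt ℝ g x₀ ∧ ∀ᶠ x in 𝓝 x₀, f x = (x - x₀) ^ n • g x := by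
  by_cases h0 : ∀ᶠ x in 𝓝 x₀, f x = 0
  · exact ⟨0, analyticAt_const, by simpa using h0⟩
  obtain ⟨m, g, hg, hg0, hfg⟩ := hf.exists_eventuallyEq_pow_smul_nonzero_iff.2 h0
  rcases le_or_gt n m with hnm | hnm
  · refine ⟨fun x => (x - x₀) ^ (m - n) • g x, ?_, ?_⟩
    · exact ((analyticAt_id.sub analyticAt_const).pow _).smul hg
    · filter_upwards [hfg] with x hx
      rw [hx, smul_smul, ← pow_add]
      congr 2; omega
  · exfalso
    have h1 : ∀ᶠ x in 𝓝[≠] x₀, ‖g x‖ ≤ D * |x - x₀| ^ (n - m) := by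
      filter_upwards [h, hfg.filter_mono nhdsWithin_le_nhds, self_mem_nhdsWithin] with x h1 h2 h3
      have hx : 0 < |x - x₀| ^ m := pow_pos (abs_pos.2 (sub_ne_zero.2 h3)) m
      rw [h2, norm_smul, norm_pow, Real.norm_eq_abs] at h1
      have h4 : |x - x₀| ^ n = |x - x₀| ^ m * |x - x₀| ^ (n - m) := by
        rw [← pow_add]; congr 1; omega
      rw [h4] at h1
      refine le_of_mul_le_mul_left ?_ hx
      linarith
    have h2 : Tendsto (fun x => ‖g x‖) (𝓝[≠] x₀) (𝓝 ‖g x₀‖) :=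
      hg.continuousAt.norm.tendsto.mono_left nhdsWithin_le_nhds
    have h3 : Tendsto (fun x => D * |x - x₀| ^ (n - m)) (𝓝[≠] x₀) (𝓝 0) := by
      have : Continuous fun x => D * |x - x₀| ^ (n - m) := by fun_prop
      have h4 := (this.tendsto x₀).mono_left (nhdsWithin_le_nhds (s := {x₀}ᶜ))
      simpa [show n - m ≠ 0 by omega] using h4
    have h4 := le_of_tendsto_of_tendsto h2 h3 h1
    exact hg0 (norm_le_zero_iff.1 h4)

/-! ### Rellich's theorem near a point -/

/-- Roots of which two differ at the base point: the polynomial factors analytically, and both factors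
are handled by induction on the degree. -/
lemma exists_analytic_roots_of_ne {d : ℕ}
    (ih : ∀ d' < d, ∀ (r : ℝ → Fin d' → ℝ) (x₀ : ℝ),
      AnalyticCoeffsAt (fun x => rootPoly (r x)) x₀ →
      ∃ θ : Fin d' → ℝ → ℝ, (∀ i, AnalyticAt ℝ (θ i) x₀) ∧
        ∀ᶠ x in 𝓝 x₀, rootPoly (r x) = rootPoly fun i => θ i x)
    {r : ℝ → Fin d → ℝ} {x₀ : ℝ} (h : AnalyticCoeffsAt (fun x => rootPoly (r x)) x₀)
    {i₀ j₀ : Fin d} (hne : r x₀ i₀ ≠ r x₀ j₀) :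
    ∃ θ : Fin d → ℝ → ℝ, (∀ i, AnalyticAt ℝ (θ i) x₀) ∧
        ∀ᶠ x in 𝓝 x₀, rootPoly (r x) = rootPoly fun i => θ i x := by
  classical
  set S : Finset (Fin d) := {i | r x₀ i = r x₀ i₀} with hS
  set p : ℝ[X] := ∏ i ∈ S, (X - C (r x₀ i)) with hp
  set q : ℝ[X] := ∏ i ∈ Sᶜ, (X - C (r x₀ i)) with hq
  have hpq : rootPoly (r x₀) = p * q := (Finset.prod_mul_prod_compl S _).symm
  have hpm : p.Monic := monic_prod_of_monic _ _ fun _ _ => monic_X_sub_C _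
  have hqm : q.Monic := monic_prod_of_monic _ _ fun _ _ => monic_X_sub_C _
  have hpd : p.natDegree = S.card := by
    rw [hp, natDegree_prod_of_monic _ _ fun _ _ => monic_X_sub_C _]; simp
  have hqd : q.natDegree = Sᶜ.card := by
    rw [hq, natDegree_prod_of_monic _ _ fun _ _ => monic_X_sub_C _]; simp
  have hc : IsCoprime p q := by
    refine IsCoprime.prod_left fun i hi => IsCoprime.prod_right fun j hj => ?_
    refine isCoprime_X_sub_C_of_isUnit_sub (sub_ne_zero.2 fun hij => ?_).isUnit
    rw [Finset.mem_compl] at hj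
    simp only [hS, Finset.mem_filter, Finset.mem_univ, true_and] at hi hj
    exact hj (hij ▸ hi)
  have hi₀ : i₀ ∈ S := by simp [hS]
  have hj₀ : j₀ ∈ Sᶜ := by simpa [hS] using hne.symm
  have hcard : S.card + Sᶜ.card = d := by simp [Finset.card_compl, S.card_le_univ.trans]
  have hSpos : 0 < S.card := Finset.card_pos.2 ⟨_, hi₀⟩
  have hScpos : 0 < Sᶜ.card := Finset.card_pos.2 ⟨_, hj₀⟩
  obtain ⟨F, G, hF, hG, hFm, hGm, hFG⟩ := exists_analytic_factorization h
    (Eventually.of_forall fun x => ⟨rootPoly_monic _, (rootPoly_natDegree _).trans hcard.symm⟩)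
    hpm hqm hpd hqd hc hpq
  -- the factors have real roots again, so the induction hypothesis applies to them
  have key : ∀ (a : ℕ), a < d → ∀ F : ℝ → ℝ[X], AnalyticCoeffsAt F x₀ →
      (∀ x, (F x).Monic ∧ (F x).natDegree = a) → (∀ᶠ x in 𝓝 x₀, (F x).Splits) →
      ∃ θ : Fin a → ℝ → ℝ, (∀ i, AnalyticAt ℝ (θ i) x₀) ∧
        ∀ᶠ x in 𝓝 x₀, F x = rootPoly fun i => θ i x := by
    intro a ha F hF hFm hFs
    have : ∀ x, ∃ s : Fin a → ℝ, (F x).Splits → F x = rootPoly s := fun x => by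
      by_cases hs : (F x).Splits
      · obtain ⟨s, hs⟩ := exists_eq_rootPoly (hFm x).1 (hFm x).2 hs
        exact ⟨s, fun _ => hs⟩
      · exact ⟨0, fun h => absurd h hs⟩
    choose s hs using this
    have hev : F =ᶠ[𝓝 x₀] fun x => rootPoly (s x) := hFs.mono fun x hx => hs x hx
    obtain ⟨θ, hθ, hθ'⟩ := ih a ha s x₀ (hF.congr hev)
    exact ⟨θ, hθ, by filter_upwards [hev, hθ'] with x h1 h2 using h1.trans h2⟩
  obtain ⟨θ, hθ, hθ'⟩ := key _ (by omega) F hF hFm (by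
    filter_upwards [hFG] with x hx
    exact (rootPoly_splits (r x)).of_dvd (rootPoly_ne_zero _) ⟨_, hx⟩)
  obtain ⟨η, hη, hη'⟩ := key _ (by omega) G hG hGm (by
    filter_upwards [hFG] with x hx
    exact (rootPoly_splits (r x)).of_dvd (rootPoly_ne_zero _) ⟨_, hx.trans (mul_comm _ _)⟩)
  generalize S.card = a at *
  generalize Sᶜ.card = b at *
  subst hcard
  refine ⟨Fin.append θ η, fun i => ?_, ?_⟩
  · refine Fin.addCases (fun i => ?_) (fun i => ?_) i
    · simpa using hθ i
    · simpa using hη i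
  · filter_upwards [hFG, hθ', hη'] with x h1 h2 h3
    rw [h1, h2, h3, ← rootPoly_append]
    congr 1
    funext i
    refine Fin.addCases (fun i => ?_) (fun i => ?_) i <;> simp

lemma rootPoly_eq_of_analytic {d : ℕ} {x₀ : ℝ} {r s : ℝ → Fin d → ℝ}
    (hr : AnalyticCoeffsAt (fun x => rootPoly (r x)) x₀)
    (hs : AnalyticCoeffsAt (fun x => rootPoly (s x)) x₀)
    (h : ∀ᶠ x in 𝓝[≠] x₀, rootPoly (r x) = rootPoly (s x)) :
    ∀ᶠ x in 𝓝 x₀, rootPoly (r x) = rootPoly (s x) := by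
  have : ∀ j : Fin d, ∀ᶠ x in 𝓝 x₀, (rootPoly (r x)).coeff j = (rootPoly (s x)).coeff j := by
    intro j
    refine ((hr j).frequently_eq_iff_eventually_eq (hs j)).1 (Eventually.frequently ?_)
    exact h.mono fun x hx => congrArg (fun P => P.coeff j) hx
  filter_upwards [eventually_all.2 this] with x hx
  exact eq_rootPoly_of_coeff fun j hj => hx ⟨j, hj⟩

/-- The case of roots with sum zero: the roots are rescaled by the largest power of `x - x₀` that
divides the sum of their squares, after which two of them differ at `x₀`. -/
lemma exists_analytic_roots_of_sum_eq_zero {d : ℕ}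
    (ih : ∀ d' < d, ∀ (r : ℝ → Fin d' → ℝ) (x₀ : ℝ),
      AnalyticCoeffsAt (fun x => rootPoly (r x)) x₀ →
      ∃ θ : Fin d' → ℝ → ℝ, (∀ i, AnalyticAt ℝ (θ i) x₀) ∧
        ∀ᶠ x in 𝓝 x₀, rootPoly (r x) = rootPoly fun i => θ i x)
    {r : ℝ → Fin d → ℝ} {x₀ : ℝ} (hd : 0 < d)
    (h : AnalyticCoeffsAt (fun x => rootPoly (r x)) x₀) (hsum : ∀ x, ∑ i, r x i = 0) :
    ∃ θ : Fin d → ℝ → ℝ, (∀ i, AnalyticAt ℝ (θ i) x₀) ∧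
        ∀ᶠ x in 𝓝 x₀, rootPoly (r x) = rootPoly fun i => θ i x := by
  have hs := sum_sq_analyticAt hd h
  by_cases h0 : ∀ᶠ x in 𝓝 x₀, ∑ i, r x i ^ 2 = 0
  · refine ⟨fun _ _ => 0, fun _ => analyticAt_const, h0.mono fun x hx => ?_⟩
    congr 1
    funext i
    have := (Finset.sum_eq_zero_iff_of_nonneg fun i _ => sq_nonneg (r x i)).1 hx i (by simp)
    exact pow_eq_zero_iff two_ne_zero |>.1 this
  obtain ⟨n, g, hg, hg0, hsg⟩ := hs.exists_eventuallyEq_pow_smul_nonzero_iff.2 h0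
  -- the order of vanishing is even, because a sum of squares does not change sign
  obtain ⟨p, rfl⟩ : Even n := by
    by_contra hn
    rw [Nat.not_even_iff_odd] at hn
    have h1 : 0 ≤ g x₀ := by
      refine ge_of_tendsto (hg.continuousAt.tendsto.mono_left
        (nhdsWithin_le_nhds (s := Set.Ioi x₀))) ?_
      filter_upwards [hsg.filter_mono nhdsWithin_le_nhds, self_mem_nhdsWithin] with x hx hx0
      have h2 : 0 ≤ (x - x₀) ^ n • g x := hx ▸ Finset.sum_nonneg fun i _ => sq_nonneg _
      exact nonneg_of_mul_nonneg_right h2 (pow_pos (sub_pos.2 hx0) n)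
    have h2 : g x₀ ≤ 0 := by
      refine le_of_tendsto (hg.continuousAt.tendsto.mono_left
        (nhdsWithin_le_nhds (s := Set.Iio x₀))) ?_
      filter_upwards [hsg.filter_mono nhdsWithin_le_nhds, self_mem_nhdsWithin] with x hx hx0
      have h2 : 0 ≤ (x - x₀) ^ n • g x := hx ▸ Finset.sum_nonneg fun i _ => sq_nonneg _
      rw [smul_eq_mul] at h2
      by_contra hpos
      exact absurd h2 (not_le.2 (mul_neg_of_neg_of_pos (hn.pow_neg (sub_neg.2 hx0))
        (not_le.1 hpos)))
    exact hg0 (le_antisymm h2 h1)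
  -- the rescaled roots, bounded near `x₀`
  set ρ : ℝ → Fin d → ℝ := fun x i => r x i / (x - x₀) ^ p with hρ
  have hρr : ∀ x, x ≠ x₀ → r x = fun i => (x - x₀) ^ p * ρ x i := fun x hx => by
    funext i
    rw [hρ]
    have : (x - x₀) ^ p ≠ 0 := pow_ne_zero _ (sub_ne_zero.2 hx)
    field_simp
  have hρs : ∀ᶠ x in 𝓝[≠] x₀, ∑ i, ρ x i ^ 2 = g x := by
    filter_upwards [hsg.filter_mono nhdsWithin_le_nhds, self_mem_nhdsWithin] with x hx hx0
    have : (x - x₀) ^ p ≠ 0 := pow_ne_zero _ (sub_ne_zero.2 hx0)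
    simp only [hρ, div_pow, ← Finset.sum_div, hx, smul_eq_mul]
    field_simp
    ring
  have hB : ∀ᶠ x in 𝓝[≠] x₀, ∀ i, |ρ x i| ≤ √(g x₀ + 1) := by
    have h1 : ∀ᶠ x in 𝓝[≠] x₀, g x < g x₀ + 1 :=
      (hg.continuousAt.eventually_lt_const (lt_add_one _)).filter_mono nhdsWithin_le_nhds
    filter_upwards [h1, hρs] with x h1 h2 i
    refine Real.abs_le_sqrt ?_
    have := Finset.single_le_sum (f := fun i => ρ x i ^ 2) (fun i _ => sq_nonneg _)
      (Finset.mem_univ i)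
    linarith
  -- the coefficients of the rescaled polynomial extend analytically
  have hcoef : ∀ j : Fin d, ∃ c : ℝ → ℝ, AnalyticAt ℝ c x₀ ∧
      ∀ᶠ x in 𝓝[≠] x₀, (rootPoly (ρ x)).coeff j = c x := by
    intro j
    obtain ⟨D, hD⟩ := exists_coeff_bound (d := d) (√(g x₀ + 1)) (j : ℕ)
    have hrel : ∀ x, x ≠ x₀ → (rootPoly (r x)).coeff j =
        (x - x₀) ^ (p * (d - j)) * (rootPoly (ρ x)).coeff j := fun x hx => by
      rw [hρr x hx, rootPoly_smul_coeff _ (pow_ne_zero _ (sub_ne_zero.2 hx)) j.2.le, pow_mul]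
    obtain ⟨c, hc, hc'⟩ := exists_eq_pow_smul_of_norm_le (h j) (D := D) (n := p * (d - j)) (by
      filter_upwards [hB, self_mem_nhdsWithin] with x hx hx0
      rw [hrel x hx0, norm_mul, norm_pow, Real.norm_eq_abs, mul_comm, Real.norm_eq_abs]
      exact mul_le_mul_of_nonneg_right (hD _ hx) (by positivity))
    refine ⟨c, hc, ?_⟩
    filter_upwards [hc'.filter_mono nhdsWithin_le_nhds, self_mem_nhdsWithin] with x hx hx0
    rw [hrel x hx0] at hx
    exact mul_left_cancel₀ (pow_ne_zero _ (sub_ne_zero.2 hx0)) hx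
  choose c hc hc' using hcoef
  obtain ⟨t, ht⟩ := exists_rootPoly_of_tendsto hB (c := fun j => c j x₀) fun j =>
    ((hc j).continuousAt.tendsto.mono_left nhdsWithin_le_nhds).congr'
      ((hc' j).mono fun x hx => hx.symm)
  set ρ' : ℝ → Fin d → ℝ := fun x => if x = x₀ then t else ρ x with hρ'
  have hρ'ne : ∀ x, x ≠ x₀ → ρ' x = ρ x := fun x hx => by simp [hρ', hx]
  have han : AnalyticCoeffsAt (fun x => rootPoly (ρ' x)) x₀ := by
    have : AnalyticCoeffsAt (fun x => monicPoly d fun j => c j x) x₀ := fun k =>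
      AnalyticAt.comp (g := fun u => (monicPoly d u).coeff k) (f := fun x j => c j x)
        (monicPoly_analytic d _ k) (analyticAt_pi_iff.2 hc)
    refine this.congr ?_
    have h1 : ∀ᶠ x in 𝓝 x₀, x ≠ x₀ → ∀ j : Fin d, (rootPoly (ρ x)).coeff j = c j x :=
      eventually_nhdsWithin_iff.1 (eventually_all.2 hc')
    filter_upwards [h1] with x hx
    rw [eq_monicPoly (rootPoly_monic (ρ' x)) (rootPoly_natDegree _)]
    congr 1
    funext j
    rcases eq_or_ne x x₀ with rfl | hx0
    · simp [hρ', ht]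
    · rw [hρ'ne x hx0, hx hx0]
  have hsq : ∑ i, ρ' x₀ i ^ 2 = g x₀ := by
    refine (((sum_sq_analyticAt hd han).frequently_eq_iff_eventually_eq hg).1
      (Eventually.frequently ?_)).self_of_nhds
    filter_upwards [hρs, self_mem_nhdsWithin] with x hx hx0
    rw [hρ'ne x hx0, hx]
  have hsum' : ∑ i, ρ' x₀ i = 0 := by
    have h1 : ∀ᶠ x in 𝓝 x₀, (rootPoly (ρ' x)).coeff (d - 1) = 0 := by
      refine ((han (d - 1)).frequently_eq_iff_eventually_eq analyticAt_const).1
        (Eventually.frequently ?_)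
      filter_upwards [self_mem_nhdsWithin] with x hx0
      rw [hρ'ne x hx0, rootPoly_coeff_pred hd, hρ]
      simp only [← Finset.sum_div, hsum, zero_div, neg_zero]
    have h2 := h1.self_of_nhds
    rwa [rootPoly_coeff_pred hd, neg_eq_zero] at h2
  -- the rescaled roots at `x₀` have sum zero and a positive sum of squares
  obtain ⟨i₀, j₀, hij⟩ : ∃ i j, ρ' x₀ i ≠ ρ' x₀ j := by
    by_contra! hall
    have h1 : ∀ i, ρ' x₀ i = 0 := fun i => by
      rw [Finset.sum_congr rfl fun j _ => hall j i] at hsum'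
      simpa [hd.ne'] using hsum'
    apply hg0
    rw [← hsq]
    simp [h1]
  obtain ⟨θ, hθ, hθ'⟩ := exists_analytic_roots_of_ne ih han hij
  have hθ2 : ∀ i, AnalyticAt ℝ (fun x => (x - x₀) ^ p * θ i x) x₀ := fun i =>
    ((analyticAt_id.sub analyticAt_const).pow p).mul (hθ i)
  refine ⟨fun i x => (x - x₀) ^ p * θ i x, hθ2, ?_⟩
  refine rootPoly_eq_of_analytic h (rootPoly_analytic hθ2) ?_
  filter_upwards [hθ'.filter_mono nhdsWithin_le_nhds, self_mem_nhdsWithin] with x hx hx0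
  have hx1 : (x - x₀) ^ p ≠ 0 := pow_ne_zero _ (sub_ne_zero.2 hx0)
  rw [hρ'ne x hx0] at hx
  refine eq_rootPoly_of_coeff fun j hj => ?_
  rw [hρr x hx0, rootPoly_smul_coeff _ hx1 hj.le, rootPoly_smul_coeff _ hx1 hj.le, hx]

/-- **Rellich's theorem**, local form: a monic polynomial with real roots whose coefficients are
real-analytic functions of one real variable has real-analytic roots. -/
theorem exists_analytic_roots (d : ℕ) : ∀ (r : ℝ → Fin d → ℝ) (x₀ : ℝ),
    AnalyticCoeffsAt (fun x => rootPoly (r x)) x₀ →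
      ∃ θ : Fin d → ℝ → ℝ, (∀ i, AnalyticAt ℝ (θ i) x₀) ∧
        ∀ᶠ x in 𝓝 x₀, rootPoly (r x) = rootPoly fun i => θ i x := by
  induction d using Nat.strong_induction_on with
  | _ d ih =>
    intro r x₀ h
    rcases Nat.eq_zero_or_pos d with rfl | hd
    · exact ⟨fun i => i.elim0, fun i => i.elim0, Eventually.of_forall fun x => by
        congr 1; exact Subsingleton.elim _ _⟩
    -- subtracting the mean reduces to roots with sum zero
    set m : ℝ → ℝ := fun x => (∑ i, r x i) / d with hm
    have hman : AnalyticAt ℝ m x₀ := by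
      have h1 : m = fun x => -(rootPoly (r x)).coeff (d - 1) / d := by
        funext x; rw [rootPoly_coeff_pred hd, neg_neg]
      rw [h1]
      exact (h (d - 1)).fun_neg.fun_div analyticAt_const (by positivity)
    have hd0 : (d : ℝ) ≠ 0 := by positivity
    have h2 : AnalyticCoeffsAt (fun x => rootPoly fun i => r x i - m x) x₀ := by
      simp only [← rootPoly_comp_X_add_C]
      exact h.comp (Eventually.of_forall fun x => rootPoly_natDegree _)
        ((AnalyticCoeffsAt.const X).add (AnalyticCoeffsAt.C hman))
    obtain ⟨θ, hθ, hθ'⟩ := exists_analytic_roots_of_sum_eq_zero ih hd h2 fun x => by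
      simp only [Finset.sum_sub_distrib, hm, Finset.sum_const, Finset.card_univ, Fintype.card_fin,
        nsmul_eq_mul]
      field_simp
      ring
    refine ⟨fun i x => θ i x + m x, fun i => (hθ i).add hman, ?_⟩
    filter_upwards [hθ'] with x hx
    have h3 := congrArg (fun P => P.comp (X + C (-m x))) hx
    simp only [rootPoly_comp_X_add_C] at h3
    simpa using h3

/-! ### Rellich's theorem on the real line -/

lemma exists_perm_of_map_univ_eq {ι α : Type*} [Fintype ι] {f g : ι → α}
    (h : (Finset.univ : Finset ι).val.map f = (Finset.univ : Finset ι).val.map g) :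
    ∃ σ : Equiv.Perm ι, ∀ i, f i = g (σ i) := by
  classical
  have hc : ∀ a, Nonempty ({i // f i = a} ≃ {i // g i = a}) := fun a => by
    refine Fintype.card_eq.1 ?_
    have h1 := congrArg (Multiset.count a) h
    rw [Multiset.count_map, Multiset.count_map] at h1
    rw [Fintype.card_subtype, Fintype.card_subtype]
    simpa [Finset.card, Finset.filter_val, eq_comm] using h1
  let e : ∀ a, {i // f i = a} ≃ {i // g i = a} := fun a => (hc a).some
  refine ⟨(Equiv.sigmaFiberEquiv f).symm.trans
    ((Equiv.sigmaCongrRight e).trans (Equiv.sigmaFiberEquiv g)), fun i => ?_⟩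
  exact ((e (f i)) ⟨i, rfl⟩).2.symm

lemma map_univ_eq_of_perm {ι α : Type*} [Fintype ι] {f g : ι → α} (σ : Equiv.Perm ι)
    (h : ∀ i, f i = g (σ i)) :
    (Finset.univ : Finset ι).val.map f = (Finset.univ : Finset ι).val.map g := by
  have : f = g ∘ σ := funext h
  rw [this, ← Multiset.map_map]
  congr 1
  simp

/-- Two tuples of analytic functions that agree as unordered tuples arbitrarily close to a point
agree near that point up to one fixed permutation: one of the finitely many permutations has to
work infinitely often. -/
lemma exists_perm_eventuallyEq {ι E : Type*} [Fintype ι] [NormedAddCommGroup E] [NormedSpace ℝ E]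
    {f g : ι → ℝ → E} {x₀ : ℝ} (hf : ∀ i, AnalyticAt ℝ (f i) x₀)
    (hg : ∀ i, AnalyticAt ℝ (g i) x₀)
    (h : ∃ᶠ x in 𝓝[≠] x₀, (Finset.univ : Finset ι).val.map (fun i => f i x) =
      (Finset.univ : Finset ι).val.map (fun i => g i x)) :
    ∃ σ : Equiv.Perm ι, ∀ i, f i =ᶠ[𝓝 x₀] g (σ i) := by
  by_contra! hno
  refine h ?_
  have h1 : ∀ σ : Equiv.Perm ι, ∀ᶠ x in 𝓝[≠] x₀, ∃ i, f i x ≠ g (σ i) x := fun σ => by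
    obtain ⟨i, hi⟩ := hno σ
    have h2 : ¬ ∃ᶠ x in 𝓝[≠] x₀, f i x = g (σ i) x := fun h3 =>
      hi (((hf i).frequently_eq_iff_eventually_eq (hg (σ i))).1 h3)
    exact (not_frequently.1 h2).mono fun x hx => ⟨i, hx⟩
  filter_upwards [eventually_all.2 h1] with x hx heq
  obtain ⟨σ, hσ⟩ := exists_perm_of_map_univ_eq heq
  obtain ⟨i, hi⟩ := hx σ
  exact hi (hσ i)

lemma rootPoly_eq_iff {d : ℕ} {r s : Fin d → ℝ} : rootPoly r = rootPoly s ↔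
    (Finset.univ : Finset (Fin d)).val.map r = (Finset.univ : Finset (Fin d)).val.map s := by
  refine ⟨fun h => by rw [← roots_rootPoly, h, roots_rootPoly], fun h => ?_⟩
  obtain ⟨σ, hσ⟩ := exists_perm_of_map_univ_eq h
  simp only [rootPoly, hσ]
  exact Equiv.prod_comp σ fun i => X - C (s i)

/-- `θ` is an analytic parametrization, near every point of `I`, of the unordered tuple `r`. -/
def AnalyticRootsOn {d : ℕ} (r : ℝ → Fin d → ℝ) (I : Set ℝ) (θ : Fin d → ℝ → ℝ) : Prop :=
  ∀ x ∈ I, (∀ i, AnalyticAt ℝ (θ i) x) ∧ ∀ᶠ y in 𝓝 x, rootPoly (r y) = rootPoly fun i => θ i y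

namespace AnalyticRootsOn

variable {d : ℕ} {r : ℝ → Fin d → ℝ}

lemma mono {I J : Set ℝ} {θ : Fin d → ℝ → ℝ} (h : AnalyticRootsOn r I θ) (hJ : J ⊆ I) :
    AnalyticRootsOn r J θ := fun x hx => h x (hJ hx)

lemma comp_perm {I : Set ℝ} {θ : Fin d → ℝ → ℝ} (h : AnalyticRootsOn r I θ)
    (σ : Equiv.Perm (Fin d)) : AnalyticRootsOn r I fun i => θ (σ i) := fun x hx =>
  ⟨fun i => (h x hx).1 (σ i), (h x hx).2.mono fun y hy => by
    rw [hy, rootPoly_eq_iff]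
    exact (map_univ_eq_of_perm σ fun i => rfl).symm⟩

lemma congr {x : ℝ} {θ η : Fin d → ℝ → ℝ} (h : AnalyticRootsOn r {x} θ)
    (he : ∀ i, η i =ᶠ[𝓝 x] θ i) : AnalyticRootsOn r {x} η := by
  rintro y rfl
  refine ⟨fun i => ((h y rfl).1 i).congr (he i).symm, ?_⟩
  filter_upwards [(h y rfl).2, eventually_all.2 he] with z h1 h2
  rw [h1]
  congr 1
  exact funext fun i => (h2 i).symm

lemma exists_perm {x : ℝ} {θ η : Fin d → ℝ → ℝ} (hθ : AnalyticRootsOn r {x} θ)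
    (hη : AnalyticRootsOn r {x} η) : ∃ σ : Equiv.Perm (Fin d), ∀ i, θ i =ᶠ[𝓝 x] η (σ i) := by
  refine exists_perm_eventuallyEq (hθ x rfl).1 (hη x rfl).1 (Eventually.frequently ?_)
  filter_upwards [(hθ x rfl).2.filter_mono nhdsWithin_le_nhds,
    (hη x rfl).2.filter_mono nhdsWithin_le_nhds] with y h1 h2
  exact rootPoly_eq_iff.1 (h1.symm.trans h2)

/-- Parametrizations on adjacent intervals fit together after a permutation of the second one. -/
lemma glue {a b c : ℝ} (hab : a ≤ b) (hbc : b ≤ c) {θ η : Fin d → ℝ → ℝ}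
    (hθ : AnalyticRootsOn r (Set.Icc a b) θ) (hη : AnalyticRootsOn r (Set.Icc b c) η) :
    ∃ ζ, AnalyticRootsOn r (Set.Icc a c) ζ := by
  obtain ⟨σ, hσ⟩ := exists_perm (x := b) (hθ.mono (by simpa using hab))
    (hη.mono (by simpa using hbc))
  refine ⟨fun i x => if x ≤ b then θ i x else η (σ i) x, fun x hx => ?_⟩
  suffices h : AnalyticRootsOn r {x} fun i x => if x ≤ b then θ i x else η (σ i) x from h x rfl
  rcases lt_trichotomy x b with hxb | rfl | hxb
  · refine (hθ.mono (J := {x}) (by simpa using ⟨hx.1, hxb.le⟩)).congr fun i => ?_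
    filter_upwards [gt_mem_nhds hxb] with y hy
    rw [if_pos (le_of_lt hy)]
  · refine (hθ.mono (J := {x}) (by simpa using hab)).congr fun i => ?_
    filter_upwards [hσ i] with y hy
    split_ifs
    · rfl
    · exact hy.symm
  · refine ((hη.comp_perm σ).mono (J := {x}) (by simpa using ⟨hxb.le, hx.2⟩)).congr fun i => ?_
    filter_upwards [lt_mem_nhds hxb] with y hy
    rw [if_neg (not_le.2 hy)]

/-- A compact interval is covered by finitely many local parametrizations, which are glued one after
the other. -/
lemma exists_Icc (h : ∀ x, AnalyticCoeffsAt (fun x => rootPoly (r x)) x) {a b : ℝ} (hab : a ≤ b) :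
    ∃ ζ, AnalyticRootsOn r (Set.Icc a b) ζ := by
  have hloc : ∀ x : ℝ, ∃ U : Set ℝ, IsOpen U ∧ x ∈ U ∧ ∃ θ, AnalyticRootsOn r U θ := fun x => by
    obtain ⟨θ, h1, h2⟩ := exists_analytic_roots d r x (h x)
    have h3 := (eventually_all.2 fun i => (h1 i).eventually_analyticAt).and
      h2.eventually_nhds
    obtain ⟨U, hU, hUo, hxU⟩ := eventually_nhds_iff.1 h3
    exact ⟨U, hUo, hxU, θ, fun y hy => hU y hy⟩
  choose U hUo hxU θ hθ using hloc
  obtain ⟨t, ht0, htm, ⟨n, hn⟩, htU⟩ := exists_monotone_Icc_subset_open_cover_Icc hab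
    (c := fun x : ℝ => (Subtype.val ⁻¹' U x : Set (Set.Icc a b)))
    (fun x => (hUo x).preimage continuous_subtype_val)
    (fun x _ => Set.mem_iUnion.2 ⟨x, hxU x⟩)
  have hstep : ∀ n, ∃ ζ, AnalyticRootsOn r (Set.Icc (t n : ℝ) (t (n + 1))) ζ := fun n => by
    obtain ⟨x, hx⟩ := htU n
    refine ⟨θ x, (hθ x).mono fun y hy => ?_⟩
    have hyab : y ∈ Set.Icc a b := ⟨(t n).2.1.trans hy.1, hy.2.trans (t (n + 1)).2.2⟩
    exact hx (show (⟨y, hyab⟩ : Set.Icc a b) ∈ Set.Icc (t n) (t (n + 1)) from hy)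
  have hind : ∀ n, ∃ ζ, AnalyticRootsOn r (Set.Icc (t 0 : ℝ) (t n)) ζ := fun n => by
    induction n with
    | zero => exact ⟨θ (t 0), (hθ _).mono (by simpa using hxU (t 0))⟩
    | succ n ih =>
      obtain ⟨ζ, hζ⟩ := ih
      obtain ⟨η, hη⟩ := hstep n
      exact glue (htm (Nat.zero_le n)) (htm (Nat.le_succ n)) hζ hη
  simpa [ht0, hn n le_rfl] using hind n

end AnalyticRootsOn

/-- **Rellich's theorem** on the real line: real roots of a monic polynomial whose coefficients are
real-analytic on `ℝ` can be labelled so as to be real-analytic on `ℝ`. -/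
theorem exists_analytic_roots_global {d : ℕ} {r : ℝ → Fin d → ℝ}
    (h : ∀ x, AnalyticCoeffsAt (fun x => rootPoly (r x)) x) :
    ∃ θ : Fin d → ℝ → ℝ, (∀ i, AnalyticOnNhd ℝ (θ i) Set.univ) ∧
      ∀ x, (Finset.univ : Finset (Fin d)).val.map (r x) =
        (Finset.univ : Finset (Fin d)).val.map fun i => θ i x := by
  have hI : ∀ n : ℕ, ∃ ζ, AnalyticRootsOn r (Set.Icc (-(n : ℝ)) n) ζ := fun n =>
    AnalyticRootsOn.exists_Icc h (by linarith [n.cast_nonneg (α := ℝ)])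
  choose ζ hζ using hI
  have h0 : ∀ n : ℕ, (0 : ℝ) ∈ Set.Icc (-(n : ℝ)) n := fun n => by simp
  -- the parametrizations on `[-n, n]` are relabelled so as to agree near `0`
  have hperm : ∀ n, ∃ σ : Equiv.Perm (Fin d), ∀ i, ζ 0 i =ᶠ[𝓝 0] ζ n (σ i) := fun n =>
    AnalyticRootsOn.exists_perm ((hζ 0).mono (by simp))
      ((hζ n).mono (by simp))
  choose σ hσ using hperm
  set η : ℕ → Fin d → ℝ → ℝ := fun n i => ζ n (σ n i) with hη
  have hηr : ∀ n : ℕ, AnalyticRootsOn r (Set.Icc (-(n : ℝ)) n) (η n) := fun n =>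
    (hζ n).comp_perm (σ n)
  have hcompat : ∀ m n : ℕ, m ≤ n → ∀ x ∈ Set.Icc (-(m : ℝ)) m, ∀ i, η m i x = η n i x := by
    intro m n hmn x hx i
    have hsub : Set.Icc (-(m : ℝ)) m ⊆ Set.Icc (-(n : ℝ)) n :=
      Set.Icc_subset_Icc (by simpa using hmn) (by simpa using hmn)
    exact AnalyticOnNhd.eqOn_of_preconnected_of_eventuallyEq
      (fun y hy => (hηr m y hy).1 i) (fun y hy => (hηr n y (hsub hy)).1 i)
      isPreconnected_Icc (h0 m) ((hσ m i).symm.trans (hσ n i)) hx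
  set Θ : Fin d → ℝ → ℝ := fun i x => η ⌈|x|⌉₊ i x
  have hΘ : ∀ x, AnalyticRootsOn r {x} Θ := fun x => by
    have hlt : |x| < (⌈|x|⌉₊ + 1 : ℕ) := by push_cast; linarith [Nat.le_ceil |x|]
    refine ((hηr (⌈|x|⌉₊ + 1)).mono (J := {x}) (by simpa using abs_le.1 hlt.le)).congr fun i => ?_
    filter_upwards [continuous_abs.continuousAt.eventually_lt_const hlt] with y hy
    exact hcompat _ _ (Nat.ceil_le.2 hy.le) y (abs_le.1 (Nat.le_ceil |y|)) i
  refine ⟨Θ, fun i x _ => (hΘ x x rfl).1 i, fun x => ?_⟩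
  exact rootPoly_eq_iff.1 (hΘ x x rfl).2.self_of_nhds

/-! ### Quotients and square roots of analytic functions, and the ring of periodic analytic functions -/

lemma eventually_ne_zero_of_analytic {E : Type*} [NormedAddCommGroup E] [NormedSpace ℝ E]
    {f : ℝ → E} (hf : AnalyticOnNhd ℝ f Set.univ) (h0 : ∃ x, f x ≠ 0) (x₀ : ℝ) :
    ∀ᶠ x in 𝓝[≠] x₀, f x ≠ 0 := by
  refine (hf x₀ trivial).eventually_eq_zero_or_eventually_ne_zero.resolve_left fun h => ?_
  obtain ⟨x, hx⟩ := h0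
  exact hx (congrFun (hf.eq_of_eventuallyEq (g := 0) (fun _ _ => analyticAt_const) h) x)

lemma mul_left_cancel_of_analytic {A : Type*} [NormedRing A] [IsDomain A] [NormedAlgebra ℝ A]
    {f u v : ℝ → A} (hf : AnalyticOnNhd ℝ f Set.univ) (h0 : ∃ x, f x ≠ 0)
    (hu : AnalyticOnNhd ℝ u Set.univ) (hv : AnalyticOnNhd ℝ v Set.univ)
    (h : ∀ x, f x * u x = f x * v x) (x : ℝ) : u x = v x := by
  have h1 := AnalyticOnNhd.eq_zero_or_eq_zero_of_mul_eq_zero hf (hu.sub hv)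
    (fun z _ => by simp [mul_sub, h z]) isPreconnected_univ
  rcases h1 with h1 | h1
  · obtain ⟨y, hy⟩ := h0
    exact absurd (h1 y trivial) hy
  · exact sub_eq_zero.1 (h1 x trivial)

/-- Division of analytic functions: a quotient bounded by `1` in absolute value has only removable
singularities. -/
lemma exists_analytic_quotient {f v : ℝ → ℂ} (hf : AnalyticOnNhd ℝ f Set.univ)
    (h0 : ∃ x, f x ≠ 0) (hv : AnalyticOnNhd ℝ v Set.univ) (hle : ∀ x, ‖v x‖ ≤ ‖f x‖) :
    ∃ u : ℝ → ℂ, AnalyticOnNhd ℝ u Set.univ ∧ ∀ x, v x = f x * u x := by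
  have hne := eventually_ne_zero_of_analytic hf h0
  have hloc : ∀ x₀, ∃ u : ℝ → ℂ, AnalyticAt ℝ u x₀ ∧ ∀ᶠ x in 𝓝 x₀, v x = f x * u x := by
    intro x₀
    have h1 : ¬ ∀ᶠ x in 𝓝 x₀, f x = 0 := fun h =>
      ((h.filter_mono nhdsWithin_le_nhds).and (hne x₀)).exists.elim fun x hx => hx.2 hx.1
    obtain ⟨n, g, hg, hg0, hfg⟩ := (hf x₀ trivial).exists_eventuallyEq_pow_smul_nonzero_iff.2 h1
    have h2 : ∀ᶠ x in 𝓝 x₀, ‖g x‖ < ‖g x₀‖ + 1 :=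
      hg.continuousAt.norm.eventually_lt_const (lt_add_one _)
    obtain ⟨w, hw, hvw⟩ := exists_eq_pow_smul_of_norm_le (hv x₀ trivial) (D := ‖g x₀‖ + 1) (n := n)
      (Eventually.filter_mono nhdsWithin_le_nhds (by
        filter_upwards [h2, hfg] with x h2 h3
        refine (hle x).trans ?_
        rw [h3, norm_smul, norm_pow, Real.norm_eq_abs, mul_comm]
        exact mul_le_mul_of_nonneg_right h2.le (by positivity)))
    refine ⟨fun x => w x / g x, hw.div hg hg0, ?_⟩
    filter_upwards [hfg, hvw, hg.continuousAt.eventually_ne hg0] with x h3 h4 h5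
    rw [h3, h4, smul_mul_assoc, mul_div_cancel₀ _ h5]
  choose U hU hvU using hloc
  set u : ℝ → ℂ := fun x => U x x
  -- local quotients agree off the isolated zeros of `f`, hence they agree
  have hu : ∀ x₀, u =ᶠ[𝓝 x₀] U x₀ := by
    intro x₀
    filter_upwards [(hvU x₀).eventually_nhds, (hU x₀).eventually_analyticAt] with y hy hya
    have h1 : ∀ᶠ z in 𝓝[≠] y, U y z = U x₀ z := by
      filter_upwards [hy.filter_mono nhdsWithin_le_nhds, (hvU y).filter_mono nhdsWithin_le_nhds,
        hne y] with z h2 h3 h4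
      exact mul_left_cancel₀ h4 (h3.symm.trans h2)
    exact (((hU y).frequently_eq_iff_eventually_eq hya).1 h1.frequently).self_of_nhds
  exact ⟨u, fun x _ => (hU x).congr (hu x).symm, fun x => (hvU x).self_of_nhds⟩

/-- A nonnegative real-analytic function on `ℝ` is the square of a real-analytic function: its
square roots are the roots of a polynomial with analytic coefficients and real roots. -/
lemma exists_analytic_sqrt {n : ℝ → ℝ} (hn : AnalyticOnNhd ℝ n Set.univ) (h0 : ∀ x, 0 ≤ n x) :
    ∃ g : ℝ → ℝ, AnalyticOnNhd ℝ g Set.univ ∧ ∀ x, g x ^ 2 = n x := by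
  set r : ℝ → Fin 2 → ℝ := fun x => ![√(n x), -√(n x)] with hr
  have h1 : ∀ x, rootPoly (r x) = X ^ 2 - C (n x) := fun x => by
    simp only [rootPoly, hr, Fin.prod_univ_two, Matrix.cons_val_zero, Matrix.cons_val_one]
    conv_rhs => rw [← Real.sq_sqrt (h0 x), C_pow]
    rw [C_neg]
    ring
  obtain ⟨θ, hθ, hm⟩ := exists_analytic_roots_global (r := r) fun x => by
    simp only [h1]
    exact (AnalyticCoeffsAt.const _).sub (AnalyticCoeffsAt.C (hn x trivial))
  refine ⟨θ 0, hθ 0, fun x => ?_⟩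
  have h2 : θ 0 x ∈ (Finset.univ : Finset (Fin 2)).val.map (r x) := by
    rw [hm x]
    exact Multiset.mem_map_of_mem (fun i => θ i x) (Finset.mem_univ (0 : Fin 2))
  obtain ⟨i, -, hi⟩ := Multiset.mem_map.1 h2
  rw [← hi]
  fin_cases i <;> simp [hr, Real.sq_sqrt (h0 x)]

lemma eq_or_eq_neg_of_sq_eq_sq_of_analytic {f g : ℝ → ℝ} (hf : AnalyticOnNhd ℝ f Set.univ)
    (hg : AnalyticOnNhd ℝ g Set.univ) (h : ∀ x, f x ^ 2 = g x ^ 2) :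
    (∀ x, f x = g x) ∨ ∀ x, f x = -g x := by
  have h1 := AnalyticOnNhd.eq_zero_or_eq_zero_of_mul_eq_zero (hf.sub hg) (hf.add hg)
    (fun z _ => by simp only [Pi.sub_apply, Pi.add_apply]; linear_combination h z)
    isPreconnected_univ
  refine h1.imp (fun h x => sub_eq_zero.1 (h x trivial)) fun h x => ?_
  exact eq_neg_of_add_eq_zero_left (h x trivial)

lemma analyticOnNhd_comp_add {E : Type*} [NormedAddCommGroup E] [NormedSpace ℝ E]
    {f : ℝ → E} (hf : AnalyticOnNhd ℝ f Set.univ) (c : ℝ) :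
    AnalyticOnNhd ℝ (fun x => f (x + c)) Set.univ := fun x _ =>
  (hf (x + c) trivial).comp_of_eq (analyticAt_id.add analyticAt_const) rfl

/-- The ring of complex-valued real-analytic functions on `ℝ` with period `T`. -/
def analyticPeriodic (T : ℝ) : Subring (ℝ → ℂ) where
  carrier := {f | AnalyticOnNhd ℝ f Set.univ ∧ Function.Periodic f T}
  mul_mem' hf hg := ⟨hf.1.mul hg.1, hf.2.mul hg.2⟩
  one_mem' := ⟨fun _ _ => analyticAt_const, fun _ => rfl⟩
  add_mem' hf hg := ⟨hf.1.add hg.1, hf.2.add hg.2⟩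
  zero_mem' := ⟨fun _ _ => analyticAt_const, fun _ => rfl⟩
  neg_mem' hf := ⟨hf.1.neg, fun x => congrArg Neg.neg (hf.2 x)⟩

namespace analyticPeriodic

variable {T : ℝ}

lemma const_mem (c : ℂ) : (fun _ => c) ∈ analyticPeriodic T :=
  ⟨fun _ _ => analyticAt_const, fun _ => rfl⟩

lemma star_mem {f : ℝ → ℂ} (hf : f ∈ analyticPeriodic T) :
    (fun x => star (f x)) ∈ analyticPeriodic T :=
  ⟨fun x hx => (Complex.conjCLE.toContinuousLinearMap.analyticAt _).comp (hf.1 x hx),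
    fun x => congrArg star (hf.2 x)⟩

lemma sum_mem {ι : Type*} (s : Finset ι) {f : ι → ℝ → ℂ}
    (hf : ∀ i ∈ s, f i ∈ analyticPeriodic T) :
    (fun x => ∑ i ∈ s, f i x) ∈ analyticPeriodic T := by
  have : (fun x => ∑ i ∈ s, f i x) = ∑ i ∈ s, f i := by ext x; simp
  rw [this]
  exact Subring.sum_mem _ hf

lemma mul_mem {f g : ℝ → ℂ} (hf : f ∈ analyticPeriodic T) (hg : g ∈ analyticPeriodic T) :
    (fun x => f x * g x) ∈ analyticPeriodic T := Subring.mul_mem _ hf hg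

lemma sub_mem {f g : ℝ → ℂ} (hf : f ∈ analyticPeriodic T) (hg : g ∈ analyticPeriodic T) :
    (fun x => f x - g x) ∈ analyticPeriodic T := Subring.sub_mem _ hf hg

lemma mul_nat_mem {f : ℝ → ℂ} (hf : f ∈ analyticPeriodic T) (n : ℕ) :
    f ∈ analyticPeriodic (T * n) :=
  ⟨hf.1, by rw [mul_comm]; exact hf.2.nat_mul n⟩

lemma shift_mem {f : ℝ → ℂ} (hf : f ∈ analyticPeriodic T) (c : ℝ) :
    (fun x => f (x + c)) ∈ analyticPeriodic T :=
  ⟨analyticOnNhd_comp_add hf.1 c, fun x => by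
    have h1 := hf.2 (x + c)
    rwa [add_right_comm] at h1⟩

instance : IsDomain (analyticPeriodic T) := by
  have : NoZeroDivisors (analyticPeriodic T) := ⟨fun {f g} h => by
    have h1 := AnalyticOnNhd.eq_zero_or_eq_zero_of_mul_eq_zero f.2.1 g.2.1
      (fun z _ => congrFun (congrArg Subtype.val h) z) isPreconnected_univ
    exact h1.imp (fun h => Subtype.ext (funext fun x => h x trivial))
      fun h => Subtype.ext (funext fun x => h x trivial)⟩
  exact NoZeroDivisors.to_isDomain _

/-- A real-analytic function whose square is periodic agrees in absolute value with a periodic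
analytic function: if the function changes sign over a period, the phase factor `e^{πix/T}`
compensates for it. -/
lemma exists_norm_eq_abs (hT : T ≠ 0) {g : ℝ → ℝ} (hg : AnalyticOnNhd ℝ g Set.univ)
    (hp : ∀ x, g (x + T) ^ 2 = g x ^ 2) : ∃ f ∈ analyticPeriodic T, ∀ x, ‖f x‖ = |g x| := by
  have hgc : AnalyticOnNhd ℝ (fun x => (g x : ℂ)) Set.univ := fun x hx =>
    (Complex.ofRealCLM.analyticAt _).comp (hg x hx)
  rcases eq_or_eq_neg_of_sq_eq_sq_of_analytic (analyticOnNhd_comp_add hg T) hg hp with h | h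
  · exact ⟨fun x => (g x : ℂ), ⟨hgc, fun x => by simp [h x]⟩, fun x => by simp⟩
  · refine ⟨fun x => (g x : ℂ) * Complex.exp ((Real.pi * x / T : ℝ) * Complex.I),
      ⟨hgc.mul fun x _ => ?_, fun x => ?_⟩, fun x => ?_⟩
    · have h1 : AnalyticAt ℝ (fun x : ℝ => ((Real.pi * x / T : ℝ) : ℂ)) x :=
        (Complex.ofRealCLM.analyticAt _).comp (f := fun x : ℝ => Real.pi * x / T)
          ((analyticAt_const.mul analyticAt_id).div analyticAt_const hT)
      exact (analyticAt_cexp.restrictScalars (𝕜 := ℝ)).comp (h1.mul analyticAt_const)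
    · have h2 : ((Real.pi * (x + T) / T : ℝ) : ℂ) * Complex.I =
          (Real.pi * x / T : ℝ) * Complex.I + Real.pi * Complex.I := by
        have : Real.pi * (x + T) / T = Real.pi * x / T + Real.pi := by field_simp
        rw [this]; push_cast; ring
      simp only [h2, Complex.exp_add, Complex.exp_pi_mul_I, h x]
      push_cast
      ring
    · rw [norm_mul, Complex.norm_exp_ofReal_mul_I, mul_one, Complex.norm_real, Real.norm_eq_abs]

/-- A singular matrix over the ring of periodic analytic functions annihilates a vector that is
normalized at every point. A null vector exists over the ring because it is a domain; dividing by
a periodic analytic function with the same absolute value as its norm removes its zeros. -/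
lemma exists_unit_null_vector (hT : T ≠ 0) {ι κ : Type*} [Fintype ι] [Fintype κ]
    {B : ℝ → Matrix κ ι ℂ} (hB : ∀ a b, (fun x => B x a b) ∈ analyticPeriodic T) {x₀ : ℝ}
    (hs : ∀ᶠ x in 𝓝[≠] x₀, ∃ v ≠ 0, B x *ᵥ v = 0) :
    ∃ u : ℝ → ι → ℂ, (∀ i, (fun x => u x i) ∈ analyticPeriodic T) ∧
      (∀ x, star (u x) ⬝ᵥ u x = 1) ∧ ∀ x, B x *ᵥ u x = 0 := by
  classical
  have hGmem : ∀ i j, (fun x => ((B x)ᴴ * B x) i j) ∈ analyticPeriodic T := fun i j => by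
    simp only [Matrix.mul_apply, Matrix.conjTranspose_apply]
    exact sum_mem _ fun k _ => mul_mem (star_mem (hB k i)) (hB k j)
  -- the Gram matrix is square, so that its singularity can be expressed by a determinant
  set G : Matrix ι ι (analyticPeriodic T) := Matrix.of fun i j => ⟨_, hGmem i j⟩ with hG
  let ev : ∀ x : ℝ, analyticPeriodic T →+* ℂ := fun x =>
    (Pi.evalRingHom (fun _ : ℝ => ℂ) x).comp (analyticPeriodic T).subtype
  have hGx : ∀ x, (ev x).mapMatrix G = (B x)ᴴ * B x := fun x => rfl
  have hdet : G.det = 0 := by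
    have h1 : ∀ᶠ x in 𝓝[≠] x₀, (G.det : ℝ → ℂ) x = 0 := by
      filter_upwards [hs] with x ⟨v, hv, hBv⟩
      have h2 : (ev x) G.det = 0 := by
        rw [RingHom.map_det, hGx, ← Matrix.exists_mulVec_eq_zero_iff]
        exact ⟨v, hv, by rw [← Matrix.mulVec_mulVec, hBv, Matrix.mulVec_zero]⟩
      exact h2
    exact Subtype.ext (G.det.2.1.eq_of_frequently_eq (g := 0) (fun _ _ => analyticAt_const)
      h1.frequently)
  obtain ⟨v, hv0, hGv⟩ := Matrix.exists_mulVec_eq_zero_iff.2 hdet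
  set w : ℝ → ι → ℂ := fun x i => (v i : ℝ → ℂ) x with hw
  have hwmem : ∀ i, (fun x => w x i) ∈ analyticPeriodic T := fun i => (v i).2
  have hBw : ∀ x, B x *ᵥ w x = 0 := fun x => by
    have h1 : ((B x)ᴴ * B x) *ᵥ w x = 0 := by
      rw [← hGx]
      funext i
      have h2 := congrArg (ev x) (congrFun hGv i)
      rw [RingHom.map_mulVec] at h2
      exact h2.trans (map_zero _)
    exact (Matrix.conjTranspose_mul_self_mulVec_eq_zero _ _).1 h1
  -- the squared norm of the null vector and its analytic square root
  set n : ℝ → ℝ := fun x => ∑ i, ‖w x i‖ ^ 2 with hn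
  have hnan : AnalyticOnNhd ℝ n Set.univ := fun x hx => by
    refine Finset.analyticAt_fun_sum _ fun i _ => ?_
    have h1 : (fun x => ‖w x i‖ ^ 2) = fun x => (star (w x i) * w x i).re := by
      funext x
      rw [Complex.star_def, mul_comm, Complex.mul_conj, Complex.ofReal_re, Complex.normSq_eq_norm_sq]
    rw [h1]
    exact (Complex.reCLM.analyticAt _).comp
      ((mul_mem (star_mem (hwmem i)) (hwmem i)).1 x hx)
  obtain ⟨g, hg, hgn⟩ := exists_analytic_sqrt hnan fun x => Finset.sum_nonneg fun i _ => by positivity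
  obtain ⟨f, hf, hfg⟩ := exists_norm_eq_abs hT hg fun x => by
    rw [hgn, hgn]
    exact Finset.sum_congr rfl fun i _ => by
      have := (hwmem i).2 x
      simp only at this
      rw [this]
  have hfn : ∀ x, ‖f x‖ ^ 2 = n x := fun x => by rw [hfg, sq_abs, hgn]
  have hf0 : ∃ x, f x ≠ 0 := by
    by_contra! hall
    apply hv0
    funext i
    refine Subtype.ext (funext fun x => ?_)
    have h1 : ∑ i, ‖w x i‖ ^ 2 = 0 := by
      have := hfn x
      rw [hall x] at this
      simpa using this.symm
    have h2 := (Finset.sum_eq_zero_iff_of_nonneg fun i _ => by positivity).1 h1 i (by simp)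
    simpa using h2
  have hdiv : ∀ i, ∃ u : ℝ → ℂ, AnalyticOnNhd ℝ u Set.univ ∧ ∀ x, w x i = f x * u x := fun i => by
    refine exists_analytic_quotient hf.1 hf0 (hwmem i).1 fun x => ?_
    refine le_of_sq_le_sq ?_ (norm_nonneg _)
    rw [hfn]
    exact Finset.single_le_sum (f := fun i => ‖w x i‖ ^ 2) (fun i _ => by positivity)
      (Finset.mem_univ i)
  choose u hu huw using hdiv
  have humem : ∀ i, u i ∈ analyticPeriodic T := fun i => ⟨hu i, fun x => by
    refine mul_left_cancel_of_analytic hf.1 hf0 (analyticOnNhd_comp_add (hu i) T) (hu i)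
      (fun x => ?_) x
    rw [← huw, ← hf.2 x, ← huw]
    exact (hwmem i).2 x⟩
  have hwu : ∀ x, w x = f x • fun i => u i x := fun x => funext fun i => huw i x
  refine ⟨fun x i => u i x, humem, fun x => ?_, fun x => ?_⟩
  · have hff : ∀ x, star (f x) * f x = (n x : ℂ) := fun x => by
      rw [Complex.star_def, mul_comm, Complex.mul_conj, Complex.normSq_eq_norm_sq, hfn]
    have h1 : (fun x => star (f x) * f x) ∈ analyticPeriodic T := mul_mem (star_mem hf) hf
    refine mul_left_cancel_of_analytic (u := fun x => star (fun i => u i x) ⬝ᵥ fun i => u i x)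
      (v := fun _ => 1) h1.1 ?_ ?_ (fun _ _ => analyticAt_const) (fun x => ?_) x
    · obtain ⟨y, hy⟩ := hf0
      exact ⟨y, mul_ne_zero (star_ne_zero.2 hy) hy⟩
    · exact (sum_mem Finset.univ fun i _ => mul_mem (star_mem (humem i)) (humem i)).1
    · have h2 : star (w x) ⬝ᵥ w x = (n x : ℂ) := by
        simp only [dotProduct, Pi.star_apply, hn, Complex.ofReal_sum]
        refine Finset.sum_congr rfl fun i _ => ?_
        rw [Complex.star_def, mul_comm, Complex.mul_conj, Complex.normSq_eq_norm_sq]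
      simp only [mul_one]
      conv_rhs => rw [hff, ← h2, hwu, star_smul, smul_dotProduct, dotProduct_smul]
      simp only [smul_eq_mul]
      ring
  · refine funext fun k => ?_
    have hBu : (fun x => (B x *ᵥ fun i => u i x) k) ∈ analyticPeriodic T :=
      sum_mem _ fun i _ => mul_mem (hB k i) (humem i)
    refine mul_left_cancel_of_analytic (v := fun _ => 0) hf.1 hf0 hBu.1
      (fun _ _ => analyticAt_const) (fun x => ?_) x
    have h1 := congrFun (hBw x) k
    rw [hwu, Matrix.mulVec_smul] at h1
    simpa using h1

end analyticPeriodic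

/-! ### Orthonormal columns of periodic analytic functions -/

namespace analyticPeriodic

variable {T : ℝ}

/-- If the kernel of a matrix of periodic analytic functions has dimension at least `q` near one
point (the point itself excepted), it contains `q` orthonormal columns of periodic analytic
functions. -/
lemma exists_orthonormal_kernel (hT : T ≠ 0) {ι κ : Type*} [Fintype ι] [Fintype κ]
    {B : ℝ → Matrix κ ι ℂ} (hB : ∀ a b, (fun x => B x a b) ∈ analyticPeriodic T) {x₀ : ℝ}
    {q : ℕ} (hq : ∀ᶠ x in 𝓝[≠] x₀, q ≤ Module.finrank ℂ (LinearMap.ker (B x).mulVecLin)) :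
    ∃ C : ℝ → Matrix ι (Fin q) ℂ, (∀ a b, (fun x => C x a b) ∈ analyticPeriodic T) ∧
      (∀ x, (C x)ᴴ * C x = 1) ∧ ∀ x, B x * C x = 0 := by
  induction q with
  | zero =>
    exact ⟨fun _ => 0, fun _ b => b.elim0, fun _ => Subsingleton.elim _ _,
      fun _ => by ext _ b; exact b.elim0⟩
  | succ q ih =>
    obtain ⟨C, hC, hCC, hBC⟩ := ih (hq.mono fun x hx => by omega)
    -- a further column is a unit null vector of `B` stacked on `Cᴴ`
    obtain ⟨u, hu, huu, hBu⟩ := exists_unit_null_vector hT (x₀ := x₀)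
      (B := fun x => Matrix.fromRows (B x) (C x)ᴴ) (by
        rintro (a | a) b
        · exact hB a b
        · exact star_mem (hC b a)) (by
        filter_upwards [hq] with x hx
        let φ : LinearMap.ker (B x).mulVecLin →ₗ[ℂ] (Fin q → ℂ) :=
          (C x)ᴴ.mulVecLin.comp (LinearMap.ker (B x).mulVecLin).subtype
        have h1 : LinearMap.ker φ ≠ ⊥ :=
          LinearMap.ker_ne_bot_of_finrank_lt (by simpa using hx)
        obtain ⟨v, hv, hv0⟩ := Submodule.exists_mem_ne_zero_of_ne_bot h1
        refine ⟨v, fun h => hv0 (Subtype.ext h), ?_⟩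
        have h2 : B x *ᵥ (v : ι → ℂ) = 0 := v.2
        have h3 : (C x)ᴴ *ᵥ (v : ι → ℂ) = 0 := hv
        rw [Matrix.fromRows_mulVec, h2, h3]
        funext k
        rcases k with k | k <;> rfl)
    have hBu1 : ∀ x, B x *ᵥ u x = 0 := fun x => by
      have h1 := hBu x
      rw [Matrix.fromRows_mulVec] at h1
      exact funext fun k => congrFun h1 (Sum.inl k)
    have hCu : ∀ x, (C x)ᴴ *ᵥ u x = 0 := fun x => by
      have h1 := hBu x
      rw [Matrix.fromRows_mulVec] at h1
      exact funext fun k => congrFun h1 (Sum.inr k)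
    refine ⟨fun x => Matrix.of fun a => Fin.snoc (α := fun _ => ℂ) (C x a) (u x a),
      fun a b => ?_, fun x => ?_, fun x => ?_⟩
    · refine Fin.lastCases ?_ (fun b => ?_) b
      · simpa using hu a
      · simpa using hC a b
    · have h1 : ∀ i, ∑ a, star (C x a i) * u x a = 0 := fun i => congrFun (hCu x) i
      have h2 : ∀ i, ∑ a, star (u x a) * C x a i = 0 := fun i => by
        have := congrArg star (h1 i)
        simpa [mul_comm] using this
      have h3 : ∀ i j, ∑ a, star (C x a i) * C x a j = (1 : Matrix (Fin q) (Fin q) ℂ) i j :=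
        fun i j => congrFun (congrFun (hCC x) i) j
      have h4 : ∑ a, star (u x a) * u x a = 1 := huu x
      ext i j
      simp only [Matrix.mul_apply, Matrix.conjTranspose_apply, Matrix.of_apply]
      refine Fin.lastCases ?_ (fun i => ?_) i <;> refine Fin.lastCases ?_ (fun j => ?_) j
      · simpa using h4
      · simpa [Matrix.one_apply, (Fin.castSucc_lt_last j).ne'] using h2 j
      · simpa [Matrix.one_apply, (Fin.castSucc_lt_last i).ne] using h1 i
      · simpa [Matrix.one_apply] using h3 i j
    · ext k j
      simp only [Matrix.mul_apply, Matrix.of_apply, Matrix.zero_apply]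
      refine Fin.lastCases ?_ (fun j => ?_) j
      · have h1 : ∑ a, B x k a * u x a = 0 := congrFun (hBu1 x) k
        simpa using h1
      · have h1 : ∑ a, B x k a * C x a j = 0 := congrFun (congrFun (hBC x) k) j
        simpa using h1

/-- Orthonormal columns of periodic analytic functions extend to a unitary matrix of periodic
analytic functions, in which they may be placed at any prescribed positions. -/
lemma exists_unitary_completion (hT : T ≠ 0) {n : ℕ} {κ : Type*} [Fintype κ] [DecidableEq κ]
    {C : ℝ → Matrix (Fin n) κ ℂ} (hC : ∀ a b, (fun x => C x a b) ∈ analyticPeriodic T)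
    (hCC : ∀ x, (C x)ᴴ * C x = 1) (e : κ ↪ Fin n) :
    ∃ W : ℝ → Matrix (Fin n) (Fin n) ℂ, (∀ a b, (fun x => W x a b) ∈ analyticPeriodic T) ∧
      (∀ x, (W x)ᴴ * W x = 1) ∧ ∀ x a k, W x a (e k) = C x a k := by
  classical
  have hcard : Fintype.card κ ≤ n := by simpa using Fintype.card_le_of_embedding e
  obtain ⟨K, hK, hKK, hCK⟩ := exists_orthonormal_kernel hT (B := fun x => (C x)ᴴ) (x₀ := 0)
    (q := n - Fintype.card κ) (fun a b => star_mem (hC b a)) (Eventually.of_forall fun x => by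
      have h1 := LinearMap.finrank_range_add_finrank_ker (C x)ᴴ.mulVecLin
      have h2 := Submodule.finrank_le (LinearMap.range (C x)ᴴ.mulVecLin)
      simp only [Module.finrank_fintype_fun_eq_card, Fintype.card_fin] at h1 h2
      omega)
  obtain ⟨f, hf⟩ : ∃ f : κ ⊕ Fin (n - Fintype.card κ) ≃ Fin n, ∀ k, f (Sum.inl k) = e k := by
    have h1 : Fintype.card (Fin (n - Fintype.card κ)) =
        Fintype.card ((Set.range e)ᶜ : Set (Fin n)) := by
      rw [Fintype.card_compl_set, Set.card_range_of_injective e.injective]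
      simp
    let g := Fintype.equivOfCardEq h1
    exact ⟨(Equiv.sumCongr (Equiv.ofInjective e e.injective) g).trans
      (Equiv.Set.sumCompl (Set.range e)), fun k => by simp⟩
  refine ⟨fun x => (Matrix.fromCols (C x) (K x)).submatrix id f.symm, fun a b => ?_, fun x => ?_,
    fun x a k => ?_⟩
  · simp only [Matrix.submatrix_apply, id]
    rcases f.symm b with k | k
    · exact hC a k
    · exact hK a k
  · have hKC : (K x)ᴴ * C x = 0 := by
      have := congrArg Matrix.conjTranspose (hCK x)
      simpa using this
    change ((C x).fromCols (K x))ᴴ.submatrix f.symm (Equiv.refl _) *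
      ((C x).fromCols (K x)).submatrix (Equiv.refl _) f.symm = 1
    rw [Matrix.submatrix_mul_equiv]
    rw [Matrix.conjTranspose_fromCols_eq_fromRows_conjTranspose, Matrix.fromRows_mul_fromCols,
      hCC, hKK, hCK, hKC, Matrix.fromBlocks_one, Matrix.submatrix_one_equiv]
  · simp [← hf]

end analyticPeriodic

/-! ### From the real line to a neighbourhood of the unit circle -/

/-- A real-analytic function extends locally to a holomorphic function. -/
lemma exists_complexification {f : ℝ → ℂ} {x₀ : ℝ} (hf : AnalyticAt ℝ f x₀) :
    ∃ g : ℂ → ℂ, AnalyticAt ℂ g x₀ ∧ ∀ᶠ x : ℝ in 𝓝 x₀, g x = f x := by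
  obtain ⟨p, hp⟩ := hf
  -- the complex power series with the same coefficients has the same radius of convergence
  set q : FormalMultilinearSeries ℂ ℂ ℂ := fun n =>
    ContinuousMultilinearMap.mkPiRing ℂ (Fin n) (p.coeff n) with hq
  have hqc : ∀ n, q.coeff n = p.coeff n := fun n => by
    generalize hc : p.coeff n = c
    change ContinuousMultilinearMap.mkPiRing ℂ (Fin n) (p.coeff n) 1 = c
    rw [ContinuousMultilinearMap.mkPiRing_apply, hc]
    simp
  have hqn : ∀ n, ‖q n‖ = ‖p n‖ := fun n => by
    rw [FormalMultilinearSeries.norm_apply_eq_norm_coef,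
      FormalMultilinearSeries.norm_apply_eq_norm_coef, hqc]
  have hrad : q.radius = p.radius :=
    le_antisymm (FormalMultilinearSeries.radius_le_of_le fun n => (hqn n).ge)
      (FormalMultilinearSeries.radius_le_of_le fun n => (hqn n).le)
  have hpos : 0 < q.radius := by
    rw [hrad]
    obtain ⟨r, hr⟩ := hp
    exact hr.r_pos.trans_le hr.r_le
  have hsum := (q.hasFPowerSeriesOnBall hpos).hasFPowerSeriesAt
  refine ⟨fun z => q.sum (z - x₀), ?_, ?_⟩
  · refine AnalyticAt.comp_of_eq (y := 0) (f := fun z : ℂ => z - x₀) ⟨q, hsum⟩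
      (analyticAt_id.sub analyticAt_const) (by simp)
  · have h1 := hasFPowerSeriesAt_iff.1 hp
    have h2 := hasFPowerSeriesAt_iff.1 hsum
    have h3 : Tendsto (fun x : ℝ => x - x₀) (𝓝 x₀) (𝓝 0) := by
      have : Continuous fun x : ℝ => x - x₀ := by fun_prop
      simpa using this.tendsto x₀
    have h4 : Tendsto (fun x : ℝ => (x : ℂ) - x₀) (𝓝 x₀) (𝓝 0) := by
      have : Continuous fun x : ℝ => (x : ℂ) - x₀ := by fun_prop
      simpa using this.tendsto x₀
    filter_upwards [h3.eventually h1, h4.eventually h2] with x h5 h6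
    rw [zero_add] at h6
    refine h6.unique ?_
    have h7 : x₀ + (x - x₀) = x := by ring
    rw [h7] at h5
    convert h5 using 2 with n
    rw [hqc, ← Complex.ofReal_sub, ← Complex.ofReal_pow, Complex.coe_smul]

lemma accPt_sphere {u : ℂ} (hu : u ∈ Metric.sphere (0 : ℂ) 1) :
    AccPt u (𝓟 (Metric.sphere (0 : ℂ) 1)) := by
  refine (isPreconnected_sphere (by simp [Complex.rank_real_complex]) (0 : ℂ) 1).preperfect_of_nontrivial
    ⟨1, by simp, -1, by simp, ?_⟩ u hu
  norm_num

lemma frequently_of_sphere {u : ℂ} (hu : u ∈ Metric.sphere (0 : ℂ) 1) {P : ℂ → Prop}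
    (h : ∀ᶠ z in 𝓝 u, z ∈ Metric.sphere (0 : ℂ) 1 → P z) : ∃ᶠ z in 𝓝[≠] u, P z := by
  have h1 := accPt_iff_frequently_nhdsNE.1 (accPt_sphere hu)
  exact (h1.and_eventually (h.filter_mono nhdsWithin_le_nhds)).mono fun z hz => hz.2 hz.1

/-- Local holomorphic extensions of a function on the unit circle fit together to a function that
is holomorphic near the circle. -/
lemma exists_analytic_extension_of_local {φ : ℂ → ℂ}
    (h : ∀ u ∈ Metric.sphere (0 : ℂ) 1, ∃ G : ℂ → ℂ, AnalyticAt ℂ G u ∧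
      ∀ᶠ z in 𝓝 u, z ∈ Metric.sphere (0 : ℂ) 1 → G z = φ z) :
    ∃ F : ℂ → ℂ, AnalyticOnNhd ℂ F (Metric.sphere 0 1) ∧
      ∀ u ∈ Metric.sphere (0 : ℂ) 1, F u = φ u := by
  classical
  set S := Metric.sphere (0 : ℂ) 1
  have h1 : ∀ u : ℂ, ∃ (G : ℂ → ℂ) (r : ℝ), u ∈ S → 0 < r ∧
      AnalyticOnNhd ℂ G (Metric.ball u (2 * r)) ∧ ∀ z ∈ Metric.ball u (2 * r), z ∈ S → G z = φ z := by
    intro u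
    by_cases hu : u ∈ S
    · obtain ⟨G, hG, hGφ⟩ := h u hu
      obtain ⟨r, hr, hb⟩ := Metric.eventually_nhds_iff_ball.1 (hG.eventually_analyticAt.and hGφ)
      refine ⟨G, r / 2, fun _ => ⟨half_pos hr, ?_, ?_⟩⟩
      · exact fun z hz => (hb z (by rwa [mul_div_cancel₀ r two_ne_zero] at hz)).1
      · exact fun z hz => (hb z (by rwa [mul_div_cancel₀ r two_ne_zero] at hz)).2
    · exact ⟨0, 0, fun h => absurd h hu⟩
  choose G r hGr using h1
  -- two extensions agree on the intersection of their discs of radius `r`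
  have hagree : ∀ u ∈ S, ∀ c ∈ S, r c ≤ r u → ∀ w ∈ Metric.ball u (r u) ∩ Metric.ball c (r c),
      G u w = G c w := by
    intro u hu c hc hle w hw
    obtain ⟨hru, hGu, hφu⟩ := hGr u hu
    obtain ⟨hrc, hGc, hφc⟩ := hGr c hc
    have hcu : c ∈ Metric.ball u (2 * r u) := by
      have := dist_triangle c w u
      rw [dist_comm c w] at this
      have h2 : dist w u < r u := hw.1
      have h3 : dist w c < r c := hw.2
      exact Metric.mem_ball.2 (by linarith)
    have hcc : c ∈ Metric.ball c (2 * r c) := Metric.mem_ball_self (by linarith)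
    -- the centre of the smaller disc lies in the larger one and is an accumulation point of the circle
    have hfreq : ∃ᶠ z in 𝓝[≠] c, G u z = G c z := frequently_of_sphere hc (by
      filter_upwards [Metric.isOpen_ball.mem_nhds hcu, Metric.isOpen_ball.mem_nhds hcc] with z h1 h2 h3
      rw [hφu z h1 h3, hφc z h2 h3])
    refine AnalyticOnNhd.eqOn_of_preconnected_of_frequently_eq
      (U := Metric.ball u (2 * r u) ∩ Metric.ball c (2 * r c))
      (hGu.mono Set.inter_subset_left) (hGc.mono Set.inter_subset_right)
      ((convex_ball _ _).inter (convex_ball _ _)).isPreconnected ⟨hcu, hcc⟩ hfreq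
      ⟨Metric.ball_subset_ball (by linarith) hw.1, Metric.ball_subset_ball (by linarith) hw.2⟩
  set F : ℂ → ℂ := fun w => if hw : ∃ c ∈ S, w ∈ Metric.ball c (r c) then G hw.choose w else 0
  have hF : ∀ u ∈ S, ∀ w ∈ Metric.ball u (r u), F w = G u w := by
    intro u hu w hw
    have hex : ∃ c ∈ S, w ∈ Metric.ball c (r c) := ⟨u, hu, hw⟩
    have h1 : F w = G hex.choose w := dif_pos hex
    obtain ⟨hc, hwc⟩ := hex.choose_spec
    rw [h1]
    rcases le_total (r hex.choose) (r u) with hle | hle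
    · exact (hagree u hu _ hc hle w ⟨hw, hwc⟩).symm
    · exact hagree _ hc u hu hle w ⟨hwc, hw⟩
  refine ⟨F, fun u hu => ?_, fun u hu => ?_⟩
  · obtain ⟨hru, hGu, -⟩ := hGr u hu
    refine (hGu u (Metric.mem_ball_self (by linarith))).congr ?_
    filter_upwards [Metric.ball_mem_nhds u hru] with w hw
    exact (hF u hu w hw).symm
  · obtain ⟨hru, -, hφ⟩ := hGr u hu
    rw [hF u hu u (Metric.mem_ball_self hru)]
    exact hφ u (Metric.mem_ball_self (by linarith)) hu

lemma exp_angle_mem_sphere (L : ℕ) (Ω : ℝ) :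
    Complex.exp (Complex.I * Ω / L) ∈ Metric.sphere (0 : ℂ) 1 := by
  have : Complex.I * Ω / L = ((Ω / L : ℝ) : ℂ) * Complex.I := by push_cast; ring
  rw [mem_sphere_zero_iff_norm, this, Complex.norm_exp_ofReal_mul_I]

lemma exists_exp_angle_eq {L : ℕ} (hL : 0 < L) {u : ℂ} (hu : u ∈ Metric.sphere (0 : ℂ) 1) :
    ∃ Ω : ℝ, Complex.exp (Complex.I * Ω / L) = u := by
  refine ⟨L * u.arg, ?_⟩
  have hL0 : (L : ℂ) ≠ 0 := by exact_mod_cast hL.ne'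
  have h1 : Complex.I * ((L * u.arg : ℝ) : ℂ) / L = u.arg * Complex.I := by
    push_cast; field_simp
  have h2 := Complex.norm_mul_exp_arg_mul_I u
  rw [mem_sphere_zero_iff_norm.1 hu] at h2
  rw [h1]
  simpa using h2

/-- A real-analytic function with period `2πL` is a function of `e^{jΩ/L}` that is holomorphic near
the unit circle. -/
lemma exists_circle_extension {L : ℕ} (hL : 0 < L) {f : ℝ → ℂ}
    (hf : f ∈ analyticPeriodic (2 * Real.pi * L)) :
    ∃ F : ℂ → ℂ, AnalyticOnNhd ℂ F (Metric.sphere 0 1) ∧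
      ∀ Ω : ℝ, F (Complex.exp (Complex.I * Ω / L)) = f Ω := by
  have hL0 : (L : ℂ) ≠ 0 := by exact_mod_cast hL.ne'
  have hLR : (L : ℝ) ≠ 0 := by exact_mod_cast hL.ne'
  have hwell : ∀ Ω Ω' : ℝ, Complex.exp (Complex.I * Ω / L) = Complex.exp (Complex.I * Ω' / L) →
      f Ω = f Ω' := by
    intro Ω Ω' h
    obtain ⟨n, hn⟩ := Complex.exp_eq_exp_iff_exists_int.1 h
    have h1 : (Ω : ℂ) = ((Ω' + n * (2 * Real.pi * L) : ℝ) : ℂ) := by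
      push_cast
      have hI := Complex.I_ne_zero
      field_simp at hn
      linear_combination hn
    rw [Complex.ofReal_inj.1 h1]
    exact hf.2.int_mul n Ω'
  set φ : ℂ → ℂ := fun w => f (L * w.arg)
  have hφ : ∀ Ω : ℝ, φ (Complex.exp (Complex.I * Ω / L)) = f Ω := by
    intro Ω
    refine hwell _ _ ?_
    set u := Complex.exp (Complex.I * Ω / L) with hu
    have h1 : Complex.I * ((L * u.arg : ℝ) : ℂ) / L = u.arg * Complex.I := by
      push_cast; field_simp
    have h2 := Complex.norm_mul_exp_arg_mul_I u
    rw [mem_sphere_zero_iff_norm.1 (exp_angle_mem_sphere L Ω)] at h2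
    rw [h1]
    simpa using h2
  obtain ⟨F, hF, hFφ⟩ := exists_analytic_extension_of_local (φ := φ) (by
    intro u hu
    obtain ⟨θ, rfl⟩ := exists_exp_angle_eq hL hu
    set u := Complex.exp (Complex.I * θ / L) with hudef
    have hu0 : u ≠ 0 := Complex.exp_ne_zero _
    obtain ⟨g, hg, hgf⟩ := exists_complexification (hf.1 θ trivial)
    have hlog : AnalyticAt ℂ (fun w : ℂ => Complex.log (w / u)) u := by
      refine (analyticAt_id.div analyticAt_const hu0).clog ?_
      simp [hu0]
    refine ⟨fun w => g (θ - Complex.I * L * Complex.log (w / u)), ?_, ?_⟩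
    · refine AnalyticAt.comp_of_eq (g := g) (y := (θ : ℂ)) hg
        (analyticAt_const.sub (analyticAt_const.mul hlog)) ?_
      simp [hu0]
    · have harg : Tendsto (fun w : ℂ => θ + L * (w / u).arg) (𝓝 u) (𝓝 θ) := by
        have h1 : ContinuousAt (fun w : ℂ => θ + L * (w / u).arg) u := by
          refine continuousAt_const.add (continuousAt_const.mul ?_)
          refine ContinuousAt.comp (g := Complex.arg) (f := fun w : ℂ => w / u)
            (Complex.continuousAt_arg ?_) (continuousAt_id.div_const u)
          simp [hu0]
        have h2 := h1.tendsto
        simpa [hu0] using h2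
      -- on the circle `θ - i L log (w / u)` is the real angle `θ + L arg (w / u)`
      filter_upwards [harg.eventually hgf] with w hw hwS
      have hnorm : ‖w / u‖ = 1 := by
        rw [norm_div, mem_sphere_zero_iff_norm.1 hwS, mem_sphere_zero_iff_norm.1 hu, div_one]
      have hlogw : Complex.log (w / u) = (w / u).arg * Complex.I := by
        rw [Complex.log, hnorm]; simp
      have h3 : (θ : ℂ) - Complex.I * L * Complex.log (w / u) =
          ((θ + L * (w / u).arg : ℝ) : ℂ) := by
        rw [hlogw]
        push_cast
        linear_combination -(L : ℂ) * (w / u).arg * Complex.I_mul_I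
      rw [h3, hw, ← hφ]
      congr 1
      have h4 : Complex.I * ((θ + L * (w / u).arg : ℝ) : ℂ) / L =
          Complex.I * θ / L + (w / u).arg * Complex.I := by
        push_cast; field_simp
      have h5 := Complex.norm_mul_exp_arg_mul_I (w / u)
      rw [hnorm, Complex.ofReal_one, one_mul] at h5
      rw [h4, Complex.exp_add, h5, ← hudef, mul_div_cancel₀ _ hu0])
  exact ⟨F, hF, fun Ω => by rw [hFφ _ (exp_angle_mem_sphere L Ω), hφ]⟩

lemma exists_circle_extension_matrix {L : ℕ} (hL : 0 < L) {m n : ℕ}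
    {W : ℝ → Matrix (Fin m) (Fin n) ℂ}
    (hW : ∀ a b, (fun x => W x a b) ∈ analyticPeriodic (2 * Real.pi * L)) :
    ∃ B : ℂ → Matrix (Fin m) (Fin n) ℂ, AnalyticOnCircle B ∧ W = onAngle L B := by
  choose F hF hFW using fun a b => exists_circle_extension hL (hW a b)
  refine ⟨fun z => Matrix.of fun a b => F a b z, fun a b => hF a b, ?_⟩
  funext Ω
  ext a b
  exact (hFW a b Ω).symm

/-- `z ↦ conj (F (1 / conj z))` is holomorphic near the unit circle if `F` is. -/
lemma analyticAt_conj_reflection {F : ℂ → ℂ} {u : ℂ} (hu : u ∈ Metric.sphere (0 : ℂ) 1)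
    (hF : AnalyticAt ℂ F u) :
    AnalyticAt ℂ (fun z => star (F (1 / starRingEnd ℂ z))) u := by
  have hu0 : u ≠ 0 := fun h => by simp [h] at hu
  have hinv : 1 / starRingEnd ℂ u = u := by
    have h1 : u * starRingEnd ℂ u = 1 := by
      rw [Complex.mul_conj, Complex.normSq_eq_norm_sq, mem_sphere_zero_iff_norm.1 hu]; simp
    rw [eq_comm, eq_div_iff (by simpa using hu0), h1]
  have hK : AnalyticAt ℂ (fun z => F (1 / z)) (starRingEnd ℂ u) := by
    refine AnalyticAt.comp_of_eq (y := u) hF (analyticAt_const.div analyticAt_id ?_) hinv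
    simpa using hu0
  rw [Complex.analyticAt_iff_eventually_differentiableAt] at hK ⊢
  filter_upwards [Complex.continuous_conj.continuousAt.eventually hK] with z hz
  have := hz.conj_conj
  rw [Complex.conj_conj] at this
  exact this

/-- A matrix function that is analytic on the unit circle and unitary there is paraunitary. -/
lemma isParaunitary_of_unitary {L : ℕ} (hL : 0 < L) {m : ℕ}
    {B : ℂ → Matrix (Fin m) (Fin m) ℂ} (hB : AnalyticOnCircle B)
    (hU : ∀ Ω, onAngle L B Ω * (onAngle L B Ω)ᴴ = 1) : IsParaunitary B := by
  refine ⟨hB, ?_⟩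
  rw [eventually_nhdsSet_iff_forall]
  intro u hu
  have h1 : ∀ a b, ∀ᶠ z in 𝓝 u,
      (B z * paraHermitian B z) a b = (1 : Matrix (Fin m) (Fin m) ℂ) a b := by
    intro a b
    have han : AnalyticAt ℂ (fun z => (B z * paraHermitian B z) a b) u := by
      simp only [Matrix.mul_apply, paraHermitian, Matrix.conjTranspose_apply]
      exact Finset.analyticAt_fun_sum _ fun c _ =>
        (hB a c u hu).fun_mul (analyticAt_conj_reflection hu (hB b c u hu))
    refine (han.frequently_eq_iff_eventually_eq analyticAt_const).1
      (frequently_of_sphere hu (Eventually.of_forall fun z hz => ?_))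
    obtain ⟨Ω, rfl⟩ := exists_exp_angle_eq hL hz
    have hinv : 1 / starRingEnd ℂ (Complex.exp (Complex.I * Ω / L)) =
        Complex.exp (Complex.I * Ω / L) := by
      have h0 := mem_sphere_zero_iff_norm.1 hz
      have h2 : Complex.exp (Complex.I * Ω / L) *
          starRingEnd ℂ (Complex.exp (Complex.I * Ω / L)) = 1 := by
        rw [Complex.mul_conj, Complex.normSq_eq_norm_sq, h0]; simp
      rw [eq_comm, eq_div_iff (by simp), h2]
    rw [paraHermitian, hinv]
    exact congrFun (congrFun (hU Ω) a) b
  filter_upwards [eventually_all.2 fun a => eventually_all.2 (h1 a)] with z hz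
  ext a b
  exact hz a b

/-! ### Singular values -/

section SingularValues

variable {M N : ℕ} (A : Matrix (Fin M) (Fin N) ℂ)

lemma adjoint_comp_self_toEuclideanLin :
    LinearMap.adjoint (Matrix.toEuclideanLin A) ∘ₗ Matrix.toEuclideanLin A =
      Matrix.toEuclideanLin (Aᴴ * A) := by
  rw [← Matrix.toEuclideanLin_conjTranspose_eq_adjoint]
  refine LinearMap.ext fun v => ?_
  simp [Matrix.toLpLin_apply, Matrix.mulVec_mulVec]

lemma finrank_euclidean_fin : Module.finrank ℂ (EuclideanSpace ℂ (Fin N)) = N := by simp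

lemma singularValues_eq_zero_of_min_le {l : ℕ} (hl : min M N ≤ l) :
    (Matrix.toEuclideanLin A).singularValues l = 0 := by
  rw [LinearMap.singularValues_eq_zero_iff_le_finrank_range]
  refine le_trans (le_min ?_ ?_) hl
  · simpa using Submodule.finrank_le (LinearMap.range (Matrix.toEuclideanLin A))
  · simpa using LinearMap.finrank_range_le (Matrix.toEuclideanLin A)

/-- The characteristic polynomial of `Aᴴ A` has the squares of the singular values as roots, next
to `N - min M N` roots that vanish. -/
lemma charpoly_conjTranspose_mul_self :
    (Aᴴ * A).charpoly = X ^ (N - min M N) *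
      (rootPoly fun l : Fin (min M N) =>
        (Matrix.toEuclideanLin A).singularValues (l : ℕ) ^ 2).map Complex.ofRealHom := by
  have h1 := (Matrix.toEuclideanLin A).isSymmetric_adjoint_comp_self.charpoly_eq
    (finrank_euclidean_fin (N := N))
  have h2 : (LinearMap.adjoint (Matrix.toEuclideanLin A) ∘ₗ Matrix.toEuclideanLin A).charpoly =
      (Aᴴ * A).charpoly := by
    rw [adjoint_comp_self_toEuclideanLin, Matrix.toEuclideanLin, Matrix.toLpLin_eq_toLin,
      Matrix.charpoly_toLin]
  rw [h2] at h1
  set s : ℕ → ℝ := fun i => (Matrix.toEuclideanLin A).singularValues i with hs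
  have h3 : (Aᴴ * A).charpoly = ∏ i ∈ Finset.range N, (X - C ((s i ^ 2 : ℝ) : ℂ)) := by
    rw [h1, Finset.prod_range]
    refine Finset.prod_congr rfl fun i _ => ?_
    rw [hs]
    simp only
    rw [(Matrix.toEuclideanLin A).sq_singularValues_fin (finrank_euclidean_fin (N := N))]
    rfl
  rw [h3, ← Finset.prod_range_mul_prod_Ico _ (min_le_right M N), mul_comm]
  congr 1
  · rw [Finset.prod_congr rfl fun i hi => by
      rw [show s i = 0 from singularValues_eq_zero_of_min_le A (Finset.mem_Ico.1 hi).1]]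
    simp
  · rw [Finset.prod_range]
    simp [rootPoly, Polynomial.map_prod, hs]

/-- The squared Frobenius norm is the sum of the squares of the singular values. -/
lemma trace_conjTranspose_mul_self_eq_sum :
    (Aᴴ * A).trace =
      ∑ l : Fin (min M N), (((Matrix.toEuclideanLin A).singularValues (l : ℕ) ^ 2 : ℝ) : ℂ) := by
  have hne : (rootPoly fun l : Fin (min M N) =>
        (Matrix.toEuclideanLin A).singularValues (l : ℕ) ^ 2).map Complex.ofRealHom ≠ 0 :=
    ((rootPoly_monic _).map _).ne_zero
  rw [Matrix.trace_eq_sum_roots_charpoly, charpoly_conjTranspose_mul_self,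
    roots_mul (mul_ne_zero (pow_ne_zero _ X_ne_zero) hne), Multiset.sum_add, roots_pow, roots_X,
    (rootPoly_splits _).roots_map, roots_rootPoly, Multiset.map_map,
    Multiset.sum_nsmul, Multiset.sum_singleton, smul_zero, zero_add]
  rfl

/-- The multiplicity of a number among the squared singular values bounds from below the dimension
of the corresponding eigenspace of `Aᴴ A`. -/
lemma card_le_finrank_ker (c : ℝ) :
    Finset.card {l : Fin (min M N) | (Matrix.toEuclideanLin A).singularValues (l : ℕ) ^ 2 = c} ≤
      Module.finrank ℂ (LinearMap.ker (Aᴴ * A - (c : ℂ) • 1).mulVecLin) := by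
  have h1 := (Matrix.toEuclideanLin A).isSymmetric_adjoint_comp_self.card_filter_eigenvalues_eq
    (finrank_euclidean_fin (N := N)) (c : ℂ)
  have h2 : Module.finrank ℂ (Module.End.eigenspace
      (LinearMap.adjoint (Matrix.toEuclideanLin A) ∘ₗ Matrix.toEuclideanLin A) (c : ℂ)) =
      Module.finrank ℂ (LinearMap.ker (Aᴴ * A - (c : ℂ) • 1).mulVecLin) := by
    refine LinearEquiv.finrank_eq
      ((WithLp.linearEquiv 2 ℂ (Fin N → ℂ)).ofSubmodules _ _ ?_)
    ext v
    simp only [Submodule.mem_map_equiv, Module.End.mem_eigenspace_iff, LinearMap.mem_ker,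
      Matrix.mulVecLin_apply, adjoint_comp_self_toEuclideanLin]
    rw [Matrix.sub_mulVec, Matrix.smul_mulVec, Matrix.one_mulVec, sub_eq_zero]
    constructor
    · intro h
      exact congrArg WithLp.ofLp h
    · intro h
      exact congrArg (WithLp.toLp 2) h
  rw [← h2, ← h1]
  refine Finset.card_le_card_of_injOn (Fin.castLE (min_le_right M N)) (fun l hl => ?_)
    (Fin.castLE_injective _).injOn
  simp only [Finset.coe_filter, Finset.mem_univ, true_and, Set.mem_ofPred_eq] at hl ⊢
  rw [← hl]
  have h3 := (Matrix.toEuclideanLin A).sq_singularValues_fin (finrank_euclidean_fin (N := N))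
    (Fin.castLE (min_le_right M N) l)
  rw [← h3]
  simp

/-- In the definition of `singularValueMultiset` the map acts on the natural numbers below `min M N`,
obtained from `Fin (min M N)` by a coercion through the monad `Multiset`. Here it is rewritten as a
map over `Fin (min M N)`. -/
lemma singularValueMultiset_eq : singularValueMultiset A =
    (Finset.univ : Finset (Fin (min M N))).val.map
      fun l : Fin (min M N) => (Matrix.toEuclideanLin A).singularValues (l : ℕ) := by
  unfold singularValueMultiset
  simp only [Multiset.bind_def, Multiset.pure_def, Multiset.bind_singleton, Multiset.map_map]
  rfl

end SingularValues

/-- The squares of the singular values of an analytic matrix function can be labelled analytically. -/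
lemma exists_analytic_sq_singularValues {M N : ℕ} {A : ℝ → Matrix (Fin M) (Fin N) ℂ}
    (hA : ∀ a b, AnalyticOnNhd ℝ (fun x => A x a b) Set.univ) :
    ∃ lam : Fin (min M N) → ℝ → ℝ, (∀ l, AnalyticOnNhd ℝ (lam l) Set.univ) ∧
      ∀ x, (Finset.univ : Finset (Fin (min M N))).val.map
          (fun l : Fin (min M N) => (Matrix.toEuclideanLin (A x)).singularValues (l : ℕ) ^ 2) =
        (Finset.univ : Finset (Fin (min M N))).val.map fun l => lam l x := by
  refine exists_analytic_roots_global (r := fun x (l : Fin (min M N)) =>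
    (Matrix.toEuclideanLin (A x)).singularValues (l : ℕ) ^ 2) fun x => ?_
  have h1 : AnalyticCoeffsAt (fun y => ((A y)ᴴ * A y).charpoly) x := by
    simp only [Matrix.charpoly, Matrix.det_apply']
    refine AnalyticCoeffsAt.sum _ fun σ _ => (AnalyticCoeffsAt.const _).mul
      (AnalyticCoeffsAt.prod _ fun i _ => ?_)
    simp only [Matrix.charmatrix_apply]
    refine (AnalyticCoeffsAt.const _).sub (AnalyticCoeffsAt.C ?_)
    simp only [Matrix.mul_apply, Matrix.conjTranspose_apply]
    exact Finset.analyticAt_fun_sum _ fun k _ =>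
      ((Complex.conjCLE.toContinuousLinearMap.analyticAt _).comp (hA _ _ x trivial)).fun_mul
        (hA _ _ x trivial)
  intro k
  have h2 := (Complex.reCLM.analyticAt _).comp (h1 (N - min M N + k))
  refine h2.congr (Eventually.of_forall fun y => ?_)
  simp only [Function.comp_apply, charpoly_conjTranspose_mul_self, add_comm (N - min M N) k,
    coeff_X_pow_mul, coeff_map]
  simp

/-! ### Existence of analytic singular values and their orbits -/

/-- The cycles of a permutation of a finite type, enumerated: each cycle is listed by iterating the
permutation on a representative. -/
lemma exists_orbit_enumeration {α : Type*} [Finite α] (T : Equiv.Perm α) :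
    ∃ (R : ℕ) (k : Fin R → ℕ) (rep : Fin R → α), (∀ ν, 0 < k ν) ∧
      (∀ ν, T^[k ν] (rep ν) = rep ν) ∧
      Function.Bijective fun y : Σ ν, Fin (k ν) => T^[(y.2 : ℕ)] (rep y.1) := by
  have := Fintype.ofFinite α
  let s := Equiv.Perm.SameCycle.setoid T
  obtain ⟨R, ⟨e⟩⟩ := Finite.exists_equiv_fin (Quotient s)
  set rep : Fin R → α := fun ν => (e.symm ν).out with hrep
  have hper : ∀ a, a ∈ Function.periodicPts T := fun a =>
    Function.mk_mem_periodicPts (orderOf_pos T) (by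
      rw [Function.IsPeriodicPt, Function.IsFixedPt, ← Equiv.Perm.coe_pow, pow_orderOf_eq_one]
      rfl)
  refine ⟨R, fun ν => Function.minimalPeriod T (rep ν), rep,
    fun ν => Function.minimalPeriod_pos_of_mem_periodicPts (hper _),
    fun ν => Function.iterate_minimalPeriod, ?_, fun a => ?_⟩
  · rintro ⟨ν, i⟩ ⟨μ, j⟩ h
    simp only at h
    have h1 : T.SameCycle (rep ν) (rep μ) := by
      refine Equiv.Perm.SameCycle.trans (y := T^[(i : ℕ)] (rep ν)) ⟨(i : ℕ), ?_⟩ ?_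
      · rw [zpow_natCast, Equiv.Perm.coe_pow]
      · rw [h]
        refine Equiv.Perm.SameCycle.symm ⟨(j : ℕ), ?_⟩
        rw [zpow_natCast, Equiv.Perm.coe_pow]
    have h2 : e.symm ν = e.symm μ := by
      have h3 : (⟦rep ν⟧ : Quotient s) = ⟦rep μ⟧ := Quotient.sound h1
      simpa [hrep] using h3
    obtain rfl := e.symm.injective h2
    have h4 : (i : ℕ) = j := Function.iterate_injOn_Iio_minimalPeriod i.2 j.2 h
    rw [Fin.ext h4]
  · have h1 : T.SameCycle (rep (e ⟦a⟧)) a := by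
      have h2 : s (e.symm (e ⟦a⟧)).out a := Quotient.exact (by simp)
      exact h2
    obtain ⟨n, -, hn⟩ := h1.exists_pow_eq'
    refine ⟨⟨e ⟦a⟧, n % Function.minimalPeriod T (rep (e ⟦a⟧)), Nat.mod_lt _
      (Function.minimalPeriod_pos_of_mem_periodicPts (hper _))⟩, ?_⟩
    simp only [Function.iterate_mod_minimalPeriod_eq]
    rw [← Equiv.Perm.coe_pow, hn]

/-- The cyclic successor in `Fin k`, with the case distinction used in `IsSignedMultiplexed`. -/
lemma val_finRotate {k : ℕ} (i : Fin k) :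
    ((finRotate k i : Fin k) : ℕ) = if (i : ℕ) + 1 < k then (i : ℕ) + 1 else 0 := by
  cases k with
  | zero => exact i.elim0
  | succ n =>
    rcases eq_or_ne i (Fin.last n) with rfl | hi
    · simp
    · have h1 : (i : ℕ) < n := lt_of_le_of_ne (Nat.le_of_lt_succ i.2) fun h => hi (Fin.ext h)
      rw [coe_finRotate_of_ne_last hi, if_pos (by omega)]

/-- The restriction of `A` to the unit circle, entrywise in the ring of `2π`-periodic analytic
functions. -/
lemma circle_mem_analyticPeriodic {M N : ℕ} {A : ℂ → Matrix (Fin M) (Fin N) ℂ}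
    (hA : AnalyticOnCircle A) (a : Fin M) (b : Fin N) :
    (fun Ω : ℝ => A (Complex.exp (Complex.I * Ω)) a b) ∈ analyticPeriodic (2 * Real.pi) := by
  refine ⟨fun Ω _ => ?_, fun Ω => ?_⟩
  · have h1 : AnalyticAt ℝ (fun Ω : ℝ => Complex.exp (Complex.I * Ω)) Ω :=
      (analyticAt_cexp.restrictScalars (𝕜 := ℝ)).comp
        (analyticAt_const.mul (Complex.ofRealCLM.analyticAt _))
    refine ((hA a b _ ?_).restrictScalars (𝕜 := ℝ)).comp h1
    simp
  · have h1 : Complex.I * ((Ω + 2 * Real.pi : ℝ) : ℂ) =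
        Complex.I * Ω + 2 * Real.pi * Complex.I := by push_cast; ring
    simp only [h1, Complex.exp_add, Complex.exp_two_pi_mul_I, mul_one]

lemma circle_periodic {M N : ℕ} (A : ℂ → Matrix (Fin M) (Fin N) ℂ) (Ω : ℝ) (n : ℕ) :
    A (Complex.exp (Complex.I * ((Ω + 2 * Real.pi * n : ℝ) : ℂ))) =
      A (Complex.exp (Complex.I * Ω)) := by
  have h1 : Complex.I * ((Ω + 2 * Real.pi * n : ℝ) : ℂ) =
      Complex.I * Ω + n * (2 * Real.pi * Complex.I) := by push_cast; ring
  rw [h1, Complex.exp_add, Complex.exp_nat_mul_two_pi_mul_I, mul_one]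

/-- Analytic singular values exist. The squares of the singular values are labelled analytically;
the shift by `2π` permutes the distinct nonzero functions among them, and its cycles are the orbits.
On each cycle an analytic square root of one function is shifted along the cycle; after one turn it
comes back up to sign. -/
theorem nonempty_singularValueOrbits {M N : ℕ} (A : ℂ → Matrix (Fin M) (Fin N) ℂ)
    (hA : AnalyticOnCircle A) : Nonempty (SingularValueOrbits A) := by
  classical
  obtain ⟨lam, hlam, hmap⟩ := exists_analytic_sq_singularValues
    (A := fun Ω : ℝ => A (Complex.exp (Complex.I * Ω)))
    fun a b => (circle_mem_analyticPeriodic hA a b).1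
  have hnonneg : ∀ l x, 0 ≤ lam l x := fun l x => by
    have h1 : lam l x ∈ (Finset.univ : Finset (Fin (min M N))).val.map fun l => lam l x :=
      Multiset.mem_map_of_mem (fun l => lam l x) (Finset.mem_univ l)
    rw [← hmap x] at h1
    obtain ⟨j, -, hj⟩ := Multiset.mem_map.1 h1
    rw [← hj]
    positivity
  -- the shift by `2π` permutes the analytic squares
  obtain ⟨τ, hτ⟩ : ∃ τ : Equiv.Perm (Fin (min M N)), ∀ l x,
      lam l (x + 2 * Real.pi) = lam (τ l) x := by
    obtain ⟨τ, hτ⟩ := exists_perm_eventuallyEq (x₀ := 0) (f := fun l x => lam l (x + 2 * Real.pi))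
      (g := lam) (fun l => analyticOnNhd_comp_add (hlam l) _ 0 trivial) (fun l => hlam l 0 trivial)
      (Eventually.frequently (Eventually.of_forall fun x => by
        rw [← hmap x, ← hmap (x + 2 * Real.pi)]
        have h1 := circle_periodic A x 1
        rw [Nat.cast_one, mul_one] at h1
        simp only [h1]))
    exact ⟨τ, fun l x => congrFun ((analyticOnNhd_comp_add (hlam l) _).eq_of_eventuallyEq
      (hlam (τ l)) (hτ l)) x⟩
  -- the distinct nonzero functions among the squares
  let F := {f : ℝ → ℝ // f ≠ 0 ∧ ∃ l, lam l = f}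
  have hfin : Finite F := by
    have : (Set.range lam).Finite := Set.finite_range lam
    exact Finite.Set.subset (Set.range lam) (fun f hf => hf.2)
  let T₀ : F → F := fun f => ⟨fun x => f.1 (x + 2 * Real.pi), fun h => f.2.1 (funext fun x => by
    have := congrFun h (x - 2 * Real.pi)
    simpa using this), by
    obtain ⟨l, hl⟩ := f.2.2
    exact ⟨τ l, funext fun x => by rw [← hτ, hl]⟩⟩
  have hT₀ : Function.Injective T₀ := fun f g h => Subtype.ext (funext fun x => by
    have := congrFun (congrArg Subtype.val h) (x - 2 * Real.pi)
    simpa [T₀] using this)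
  let T : Equiv.Perm F := Equiv.ofBijective T₀ (Finite.injective_iff_bijective.1 hT₀)
  have hTx : ∀ (f : F) x, (T f).1 x = f.1 (x + 2 * Real.pi) := fun f x => rfl
  have hTi : ∀ (n : ℕ) (f : F) x, (T^[n] f).1 x = f.1 (x + 2 * Real.pi * n) := fun n => by
    induction n with
    | zero => intro f x; simp
    | succ n ih =>
      intro f x
      have h1 : x + 2 * Real.pi * n + 2 * Real.pi = x + 2 * Real.pi * (n + 1 : ℕ) := by
        push_cast; ring
      rw [Function.iterate_succ_apply, ih, hTx, h1]
  obtain ⟨R, k, rep, hk, hrep, hbij⟩ := exists_orbit_enumeration T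
  let E : (Σ ν, Fin (k ν)) ≃ F := Equiv.ofBijective _ hbij
  have hE : ∀ ν i, E ⟨ν, i⟩ = T^[(i : ℕ)] (rep ν) := fun ν i => rfl
  have hsqrt : ∀ ν, ∃ g : ℝ → ℝ, AnalyticOnNhd ℝ g Set.univ ∧ ∀ x, g x ^ 2 = (rep ν).1 x := by
    intro ν
    obtain ⟨l, hl⟩ := (rep ν).2.2
    rw [← hl]
    exact exists_analytic_sqrt (hlam l) (hnonneg l)
  choose ρ hρ hρsq using hsqrt
  set σ : (ν : Fin R) → Fin (k ν) → ℝ → ℝ := fun ν i Ω => ρ ν (Ω + 2 * Real.pi * (i : ℕ)) with hσ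
  have hσsq : ∀ (y : Σ ν, Fin (k ν)) Ω, σ y.1 y.2 Ω ^ 2 = (E y).1 Ω := fun y Ω => by
    rw [hE, hTi, ← hρsq]
  -- the multiplicity is constant along an orbit
  have hmult : ∀ f : F, Nat.card {l // lam l = (T f).1} = Nat.card {l // lam l = f.1} := by
    intro f
    refine (Nat.card_congr (Equiv.subtypeEquiv τ fun l => ?_)).symm
    constructor
    · intro h
      exact funext fun x => by rw [hTx, ← hτ, h]
    · intro h
      refine funext fun x => ?_
      have h1 := congrFun h (x - 2 * Real.pi)
      rw [hTx, ← hτ] at h1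
      simpa using h1
  have hmulti : ∀ (n : ℕ) (f : F),
      Nat.card {l // lam l = (T^[n] f).1} = Nat.card {l // lam l = f.1} := fun n => by
    induction n with
    | zero => exact fun f => rfl
    | succ n ih => exact fun f => by rw [Function.iterate_succ_apply, ih, hmult]
  set q : Fin R → ℕ := fun ν => Nat.card {l // lam l = (rep ν).1} with hq
  have hg : ∀ y : Σ ν, Fin (k ν), Nonempty (Fin (q y.1) ≃ {l // lam l = (E y).1}) := fun y => by
    refine ⟨(Finite.equivFinOfCardEq ?_).symm⟩
    exact hmulti _ _
  -- `g ⟨ν, i⟩` numbers the diagonal positions of the `i`-th function of the orbit `ν`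
  let g : ∀ y : Σ ν, Fin (k ν), Fin (q y.1) ≃ {l // lam l = (E y).1} := fun y => (hg y).some
  set diag : Fin (min M N) → ℝ → ℝ := fun l =>
    if h : lam l ≠ 0 then
      σ (E.symm ⟨lam l, h, l, rfl⟩).1 (E.symm ⟨lam l, h, l, rfl⟩).2 else 0 with hdiag
  have hσan : ∀ ν i, AnalyticOnNhd ℝ (σ ν i) Set.univ := fun ν i =>
    analyticOnNhd_comp_add (hρ ν) _
  have hdiagsq : ∀ l Ω, diag l Ω ^ 2 = lam l Ω := fun l Ω => by
    by_cases h : lam l ≠ 0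
    · simp only [hdiag, dif_pos h]
      rw [hσsq, Equiv.apply_symm_apply]
    · simp only [hdiag, dif_neg h]
      rw [not_not.1 h]
      simp
  let posF : (Σ ν : Fin R, Fin (k ν) × Fin (q ν)) → Fin (min M N) := fun y =>
    (g ⟨y.1, y.2.1⟩ y.2.2).1
  have hposlam : ∀ ν i t, lam (posF ⟨ν, i, t⟩) = (E ⟨ν, i⟩).1 := fun ν i t =>
    (g ⟨ν, i⟩ t).2
  have hposinj : Function.Injective posF := by
    rintro ⟨ν, i, t⟩ ⟨μ, j, s⟩ h
    have h1 : E ⟨ν, i⟩ = E ⟨μ, j⟩ := Subtype.ext (by rw [← hposlam ν i t, ← hposlam μ j s, h])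
    have h2 := E.injective h1
    cases h2
    have h3 : t = s := (g ⟨ν, i⟩).injective (Subtype.ext h)
    rw [h3]
  refine ⟨{ diag := diag, R := R, k := k, k_pos := hk, q := q, σ := σ, pos := ⟨posF, hposinj⟩,
            κ := fun ν => if ∀ x, ρ ν (x + 2 * Real.pi * k ν) = ρ ν x then 1 else 2
            analytic := ?analytic
            abs_diag := ?abs_diag
            κ_eq := ?κ_eq
            q_pos := ?q_pos
            σ_distinct := ?σ_distinct
            σ_ne_zero := ?σ_ne_zero
            diag_pos := ?diag_pos
            diag_zero := ?diag_zero
            multiplexed := ?multiplexed }⟩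
  case analytic =>
    intro l
    by_cases h : lam l ≠ 0
    · simp only [hdiag, dif_pos h]
      exact hσan _ _
    · simp only [hdiag, dif_neg h]
      exact fun _ _ => analyticAt_const
  case abs_diag =>
    intro Ω
    have h1 := congrArg (Multiset.map Real.sqrt) (hmap Ω)
    rw [Multiset.map_map, Multiset.map_map] at h1
    rw [singularValueMultiset_eq]
    refine (Multiset.map_congr rfl fun l _ => ?_).trans (h1.symm.trans
      (Multiset.map_congr rfl fun l _ => ?_))
    · rw [Function.comp_apply, ← hdiagsq, Real.sqrt_sq_eq_abs]
    · exact Real.sqrt_sq (LinearMap.singularValues_nonneg _ _)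
  case κ_eq =>
    intro ν
    by_cases h : ∀ x, ρ ν (x + 2 * Real.pi * k ν) = ρ ν x <;> simp [h]
  case q_pos =>
    intro ν
    obtain ⟨l, hl⟩ := (rep ν).2.2
    exact Nat.card_pos_iff.2 ⟨⟨⟨l, hl⟩⟩, inferInstance⟩
  case σ_distinct =>
    intro x y h
    refine E.injective (Subtype.ext (funext fun Ω => ?_))
    rw [← hσsq, ← hσsq, ← sq_abs, h Ω, sq_abs]
  case σ_ne_zero =>
    intro ν i
    by_contra! h
    refine (E ⟨ν, i⟩).2.1 (funext fun Ω => ?_)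
    rw [← hσsq, h Ω]
    simp
  case diag_pos =>
    intro ν i t
    have h1 : lam (posF ⟨ν, i, t⟩) ≠ 0 := by
      rw [hposlam]
      exact (E ⟨ν, i⟩).2.1
    have h2 : E.symm ⟨lam (posF ⟨ν, i, t⟩), h1, posF ⟨ν, i, t⟩, rfl⟩ = ⟨ν, i⟩ := by
      rw [Equiv.symm_apply_eq]
      exact Subtype.ext (hposlam ν i t)
    change diag (posF ⟨ν, i, t⟩) = σ ν i
    simp only [hdiag, dif_pos h1]
    rw [h2]
  case diag_zero =>
    intro l hl Ω
    by_cases h : lam l ≠ 0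
    · exfalso
      apply hl
      obtain ⟨⟨ν, i⟩, hνi⟩ := E.surjective ⟨lam l, h, l, rfl⟩
      have h1 : lam l = (E ⟨ν, i⟩).1 := by rw [hνi]
      refine ⟨⟨ν, i, (g ⟨ν, i⟩).symm ⟨l, h1⟩⟩, ?_⟩
      change (g ⟨ν, i⟩ ((g ⟨ν, i⟩).symm ⟨l, h1⟩)).1 = l
      rw [Equiv.apply_symm_apply]
    · simp only [hdiag, dif_neg h, Pi.zero_apply]
  case multiplexed =>
    intro ν i Ω
    simp only [hσ, val_finRotate]
    split_ifs with h1 h2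
    · rw [one_mul]
      congr 1
      push_cast
      ring
    · have h3 : ((i : ℕ) : ℝ) + 1 = k ν := by exact_mod_cast (by omega : (i : ℕ) + 1 = k ν)
      have h4 := h2 Ω
      rw [← h3] at h4
      simp only [Nat.cast_zero, mul_zero, add_zero, le_refl, tsub_eq_zero_of_le, pow_zero, one_mul]
      rw [← h4]
      congr 1
      ring
    · have h3 : ((i : ℕ) : ℝ) + 1 = k ν := by exact_mod_cast (by omega : (i : ℕ) + 1 = k ν)
      have h4 : ∀ x, ρ ν (x + 2 * Real.pi * k ν) = -ρ ν x :=
        (eq_or_eq_neg_of_sq_eq_sq_of_analytic (analyticOnNhd_comp_add (hρ ν) _) (hρ ν) fun x => by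
          rw [hρsq, hρsq, ← hTi, hrep]).resolve_left h2
      have h5 := h4 Ω
      rw [← h3] at h5
      simp only [Nat.cast_zero, mul_zero, add_zero, Nat.add_one_sub_one, pow_one, neg_mul, one_mul]
      rw [← h5]
      congr 1
      ring

/-! ### Singular vectors of one orbit -/

/-- The shifts by `2πi` of one `2πk`-periodic function are `k`-multiplexed. -/
lemma isMultiplexed_of_shift {α : Type*} {k : ℕ} {f : Fin k → ℝ → α} {g : ℝ → α}
    (hg : Function.Periodic g (2 * Real.pi * k))
    (hf : ∀ i Ω, f i Ω = g (Ω + 2 * Real.pi * (i : ℕ))) : IsMultiplexed k f := by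
  intro i Ω
  rw [hf, hf, val_finRotate]
  split_ifs with h
  · congr 1
    push_cast
    ring
  · have h3 : ((i : ℕ) : ℝ) + 1 = k := by exact_mod_cast (by omega : (i : ℕ) + 1 = k)
    rw [Nat.cast_zero, mul_zero, add_zero, ← hg Ω, ← h3]
    congr 1
    ring

lemma periodic_of_shift {α : Type*} {k : ℕ} {f : Fin k → ℝ → α} {g : ℝ → α}
    (hg : Function.Periodic g (2 * Real.pi * k))
    (hf : ∀ i Ω, f i Ω = g (Ω + 2 * Real.pi * (i : ℕ))) (i : Fin k) :
    Function.Periodic (f i) (2 * Real.pi * k) := by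
  intro Ω
  rw [hf, hf, ← hg (Ω + 2 * Real.pi * (i : ℕ))]
  congr 1
  ring

namespace SingularValueOrbits

variable {M N : ℕ} {A : ℂ → Matrix (Fin M) (Fin N) ℂ} (D : SingularValueOrbits A)

/-- The first singular value of an orbit. -/
def head (ν : Fin D.R) : ℝ → ℝ := D.σ ν ⟨0, D.k_pos ν⟩

/-- The other members of an orbit are the shifts of the first one. -/
lemma σ_eq_shift (ν : Fin D.R) (n : ℕ) (hn : n < D.k ν) (Ω : ℝ) :
    D.σ ν ⟨n, hn⟩ Ω = D.head ν (Ω + 2 * Real.pi * n) := by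
  induction n generalizing Ω with
  | zero => simp [head]
  | succ n ih =>
    have h1 := D.multiplexed ν ⟨n, by omega⟩ Ω
    have h2 : finRotate (D.k ν) ⟨n, by omega⟩ = ⟨n + 1, hn⟩ :=
      Fin.ext (by rw [val_finRotate, if_pos hn])
    rw [if_pos hn, one_mul, h2, ih (by omega)] at h1
    rw [← h1]
    congr 1
    push_cast
    ring

lemma head_add_period (ν : Fin D.R) (Ω : ℝ) :
    D.head ν (Ω + 2 * Real.pi * D.k ν) = (-1) ^ (D.κ ν - 1) * D.head ν Ω := by
  have hk := D.k_pos ν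
  have hlt : D.k ν - 1 < D.k ν := by omega
  have h1 := D.multiplexed ν ⟨D.k ν - 1, hlt⟩ Ω
  have h2 : finRotate (D.k ν) ⟨D.k ν - 1, hlt⟩ = ⟨0, hk⟩ := Fin.ext (by
    rw [val_finRotate, if_neg (by simp only; omega)])
  rw [if_neg (by simp only; omega), h2, σ_eq_shift] at h1
  rw [head] at h1 ⊢
  rw [← h1]
  congr 1
  rw [Nat.cast_sub hk, Nat.cast_one]
  ring

lemma σ_analytic (ν : Fin D.R) (i : Fin (D.k ν)) : AnalyticOnNhd ℝ (D.σ ν i) Set.univ := by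
  rw [← D.diag_pos ν i ⟨0, D.q_pos ν⟩]
  exact D.analytic _

/-- The first diagonal entry of an orbit, `σ e^{jΩ/(kκ)}`. -/
noncomputable def entry (ν : Fin D.R) (Ω : ℝ) : ℂ := D.head ν Ω * phase (D.k ν * D.κ ν) 0 Ω

lemma norm_phase (p i : ℕ) (Ω : ℝ) : ‖phase p i Ω‖ = 1 := by
  have h1 : Complex.I * Ω / p = ((Ω / p : ℝ) : ℂ) * Complex.I := by push_cast; ring
  have h2 : 2 * (Real.pi : ℂ) * Complex.I / p = ((2 * Real.pi / p : ℝ) : ℂ) * Complex.I := by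
    push_cast; ring
  rw [phase, norm_mul, norm_pow, h1, h2, Complex.norm_exp_ofReal_mul_I,
    Complex.norm_exp_ofReal_mul_I]
  simp

lemma phase_add (p n : ℕ) (Ω : ℝ) : phase p 0 (Ω + 2 * Real.pi * n) = phase p n Ω := by
  have h1 : Complex.I * ((Ω + 2 * Real.pi * n : ℝ) : ℂ) / p =
      Complex.I * Ω / p + n * (2 * Real.pi * Complex.I / p) := by
    push_cast; ring
  rw [phase, phase, h1, Complex.exp_add, Complex.exp_nat_mul]
  simp

lemma phase_add_period {k κ : ℕ} (hk : 0 < k) (hκ : κ = 1 ∨ κ = 2) (Ω : ℝ) :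
    phase (k * κ) 0 (Ω + 2 * Real.pi * k) = (-1) ^ (κ - 1) * phase (k * κ) 0 Ω := by
  have hk0 : (k : ℂ) ≠ 0 := by exact_mod_cast hk.ne'
  rw [phase_add, phase, phase, ← Complex.exp_nat_mul, pow_zero, mul_one, mul_comm]
  congr 1
  rcases hκ with rfl | rfl
  · have h1 : (k : ℂ) * (2 * Real.pi * Complex.I / (k * 1 : ℕ)) = 2 * Real.pi * Complex.I := by
      push_cast; field_simp
    rw [h1, Complex.exp_two_pi_mul_I]
    simp
  · have h1 : (k : ℂ) * (2 * Real.pi * Complex.I / (k * 2 : ℕ)) = Real.pi * Complex.I := by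
      push_cast; field_simp
    rw [h1, Complex.exp_pi_mul_I]
    simp

lemma norm_entry (ν : Fin D.R) (Ω : ℝ) : ‖D.entry ν Ω‖ = |D.head ν Ω| := by
  rw [entry, norm_mul, norm_phase, mul_one, Complex.norm_real, Real.norm_eq_abs]

lemma entry_shift (ν : Fin D.R) (i : Fin (D.k ν)) (Ω : ℝ) :
    D.entry ν (Ω + 2 * Real.pi * (i : ℕ)) = D.σ ν i Ω * phase (D.k ν * D.κ ν) i Ω := by
  rw [entry, phase_add, ← D.σ_eq_shift ν i i.2]

lemma phase_analytic (p i : ℕ) : AnalyticOnNhd ℝ (phase p i) Set.univ := fun _ _ =>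
  AnalyticAt.mul ((analyticAt_cexp.restrictScalars (𝕜 := ℝ)).comp
    (f := fun Ω : ℝ => Complex.I * Ω / p)
    ((analyticAt_const.mul (Complex.ofRealCLM.analyticAt _)).mul analyticAt_const))
    analyticAt_const

/-- The sign picked up by a signed multiplexed singular value over a full turn is cancelled by the
phase factor. -/
lemma entry_mem (ν : Fin D.R) : D.entry ν ∈ analyticPeriodic (2 * Real.pi * D.k ν) := by
  refine ⟨fun Ω hΩ => AnalyticAt.mul ((Complex.ofRealCLM.analyticAt _).comp
    (D.σ_analytic ν _ Ω hΩ)) (phase_analytic _ _ Ω hΩ), fun Ω => ?_⟩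
  rw [entry, entry, D.head_add_period, phase_add_period (D.k_pos ν) (D.κ_eq ν)]
  have h1 : ((-1 : ℂ) ^ (D.κ ν - 1)) * (-1) ^ (D.κ ν - 1) = 1 := by
    rw [← mul_pow]; simp
  push_cast
  linear_combination (D.head ν Ω : ℂ) * phase (D.k ν * D.κ ν) 0 Ω * h1

lemma entry_ne_zero (ν : Fin D.R) : ∃ Ω, D.entry ν Ω ≠ 0 := by
  obtain ⟨Ω, hΩ⟩ := D.σ_ne_zero ν ⟨0, D.k_pos ν⟩
  refine ⟨Ω, norm_ne_zero_iff.1 ?_⟩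
  rw [norm_entry]
  exact abs_ne_zero.2 hΩ

lemma exists_perm_singularValues (Ω : ℝ) : ∃ π : Equiv.Perm (Fin (min M N)), ∀ l,
    |D.diag l Ω| = (Matrix.toEuclideanLin (A (Complex.exp (Complex.I * Ω)))).singularValues
      (π l : ℕ) := by
  refine exists_perm_of_map_univ_eq (g := fun l : Fin (min M N) =>
    (Matrix.toEuclideanLin (A (Complex.exp (Complex.I * Ω)))).singularValues (l : ℕ)) ?_
  rw [D.abs_diag, singularValueMultiset_eq]

/-- The eigenspace of `Aᴴ A` for the square of a singular value of the orbit has at least the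
multiplicity of the orbit as dimension; it is larger where analytic singular values cross. -/
lemma q_le_finrank (ν : Fin D.R) (Ω : ℝ) : D.q ν ≤ Module.finrank ℂ (LinearMap.ker
    ((A (Complex.exp (Complex.I * Ω)))ᴴ * A (Complex.exp (Complex.I * Ω)) -
      ((D.head ν Ω ^ 2 : ℝ) : ℂ) • 1).mulVecLin) := by
  refine le_trans ?_ (card_le_finrank_ker _ _)
  obtain ⟨π, hπ⟩ := D.exists_perm_singularValues Ω
  have h1 := Finset.card_le_card_of_injOn (s := (Finset.univ : Finset (Fin (D.q ν))))
    (t := {l : Fin (min M N) | (Matrix.toEuclideanLin (A (Complex.exp (Complex.I * Ω)))).singularValues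
      (l : ℕ) ^ 2 = D.head ν Ω ^ 2}) (fun t => π (D.pos ⟨ν, ⟨0, D.k_pos ν⟩, t⟩)) (fun t _ => by
        simp only [Finset.coe_filter, Finset.mem_univ, true_and, Set.mem_ofPred_eq]
        rw [← hπ, sq_abs, D.diag_pos, head])
    (fun t _ s _ h => by simpa using D.pos.injective (π.injective h))
  simpa using h1

/-- Right singular vectors of the first singular value of an orbit: orthonormal eigenvectors of
`Aᴴ A`, analytic with the period `2πk` of the eigenvalue. The left ones are the quotients
`A v / s`, whose singularities are removable. -/
lemma exists_singular_vectors (hA : AnalyticOnCircle A) (ν : Fin D.R) :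
    ∃ (v : ℝ → Matrix (Fin N) (Fin (D.q ν)) ℂ) (u : ℝ → Matrix (Fin M) (Fin (D.q ν)) ℂ),
      (∀ a b, (fun x => v x a b) ∈ analyticPeriodic (2 * Real.pi * D.k ν)) ∧
      (∀ a b, (fun x => u x a b) ∈ analyticPeriodic (2 * Real.pi * D.k ν)) ∧
      (∀ Ω, (v Ω)ᴴ * v Ω = 1) ∧
      (∀ Ω : ℝ, (A (Complex.exp (Complex.I * Ω)))ᴴ * A (Complex.exp (Complex.I * Ω)) * v Ω =
        ((D.head ν Ω ^ 2 : ℝ) : ℂ) • v Ω) ∧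
      ∀ Ω : ℝ, A (Complex.exp (Complex.I * Ω)) * v Ω = D.entry ν Ω • u Ω := by
  have hT : 2 * Real.pi * D.k ν ≠ 0 := by
    have := D.k_pos ν
    positivity
  have hAm : ∀ a b, (fun Ω : ℝ => A (Complex.exp (Complex.I * Ω)) a b) ∈
      analyticPeriodic (2 * Real.pi * D.k ν) := fun a b =>
    analyticPeriodic.mul_nat_mem (circle_mem_analyticPeriodic hA a b) _
  have hsq : (fun Ω => ((D.head ν Ω ^ 2 : ℝ) : ℂ)) ∈ analyticPeriodic (2 * Real.pi * D.k ν) := by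
    refine ⟨fun Ω hΩ => (Complex.ofRealCLM.analyticAt _).comp ((D.σ_analytic ν _ Ω hΩ).pow 2),
      fun Ω => ?_⟩
    simp only [D.head_add_period, mul_pow, ← pow_mul]
    simp [mul_comm _ 2]
  obtain ⟨v, hv, hvv, hBv⟩ := analyticPeriodic.exists_orthonormal_kernel hT (x₀ := 0)
    (B := fun Ω : ℝ => (A (Complex.exp (Complex.I * Ω)))ᴴ * A (Complex.exp (Complex.I * Ω)) -
      ((D.head ν Ω ^ 2 : ℝ) : ℂ) • 1) (q := D.q ν) (fun a b => by
        simp only [Matrix.sub_apply, Matrix.mul_apply, Matrix.conjTranspose_apply,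
          Matrix.smul_apply, smul_eq_mul]
        refine analyticPeriodic.sub_mem (analyticPeriodic.sum_mem _ fun c _ =>
          analyticPeriodic.mul_mem (analyticPeriodic.star_mem (hAm c a)) (hAm c b)) ?_
        exact analyticPeriodic.mul_mem hsq (analyticPeriodic.const_mem _))
    (Eventually.of_forall fun Ω => D.q_le_finrank ν Ω)
  have heig : ∀ Ω : ℝ, (A (Complex.exp (Complex.I * Ω)))ᴴ * A (Complex.exp (Complex.I * Ω)) * v Ω =
      ((D.head ν Ω ^ 2 : ℝ) : ℂ) • v Ω := fun Ω => by
    have h1 := hBv Ω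
    rwa [Matrix.sub_mul, sub_eq_zero, Matrix.smul_mul, Matrix.one_mul] at h1
  have hAv : ∀ a t, (fun Ω : ℝ => (A (Complex.exp (Complex.I * Ω)) * v Ω) a t) ∈
      analyticPeriodic (2 * Real.pi * D.k ν) := fun a t => by
    simp only [Matrix.mul_apply]
    exact analyticPeriodic.sum_mem _ fun c _ => analyticPeriodic.mul_mem (hAm a c) (hv c t)
  have hnorm : ∀ (Ω : ℝ) t, ∑ a, ‖(A (Complex.exp (Complex.I * Ω)) * v Ω) a t‖ ^ 2 =
      D.head ν Ω ^ 2 := fun Ω t => by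
    have h1 : ((A (Complex.exp (Complex.I * Ω)) * v Ω)ᴴ * (A (Complex.exp (Complex.I * Ω)) * v Ω)) =
        ((D.head ν Ω ^ 2 : ℝ) : ℂ) • (1 : Matrix (Fin (D.q ν)) (Fin (D.q ν)) ℂ) := by
      rw [Matrix.conjTranspose_mul, Matrix.mul_assoc, ← Matrix.mul_assoc _ _ (v Ω), heig,
        Matrix.mul_smul, hvv]
    have h2 := congrFun (congrFun h1 t) t
    simp only [Matrix.mul_apply, Matrix.conjTranspose_apply, Matrix.smul_apply,
      Matrix.one_apply_eq, smul_eq_mul, mul_one] at h2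
    have h3 : ((∑ a, ‖(A (Complex.exp (Complex.I * Ω)) * v Ω) a t‖ ^ 2 : ℝ) : ℂ) =
        ((D.head ν Ω ^ 2 : ℝ) : ℂ) := by
      rw [← h2, Complex.ofReal_sum]
      refine Finset.sum_congr rfl fun a _ => ?_
      rw [← Complex.normSq_eq_norm_sq, ← Complex.mul_conj, mul_comm]
      simp only [Matrix.mul_apply, Complex.star_def]
    exact Complex.ofReal_inj.1 h3
  have hdiv : ∀ a t, ∃ u : ℝ → ℂ, AnalyticOnNhd ℝ u Set.univ ∧
      ∀ Ω : ℝ, (A (Complex.exp (Complex.I * Ω)) * v Ω) a t = D.entry ν Ω * u Ω := fun a t => by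
    refine exists_analytic_quotient (D.entry_mem ν).1 (D.entry_ne_zero ν) (hAv a t).1 fun Ω => ?_
    rw [norm_entry]
    refine Real.sqrt_sq_eq_abs (D.head ν Ω) ▸ Real.le_sqrt_of_sq_le ?_
    rw [← hnorm Ω t]
    exact Finset.single_le_sum
      (f := fun a => ‖(A (Complex.exp (Complex.I * Ω)) * v Ω) a t‖ ^ 2)
      (fun i _ => by positivity) (Finset.mem_univ a)
  choose u hu hAvu using hdiv
  refine ⟨v, fun Ω => Matrix.of fun a t => u a t Ω, hv, fun a t => ⟨hu a t, fun Ω => ?_⟩, hvv, heig,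
    fun Ω => ?_⟩
  · refine mul_left_cancel_of_analytic (D.entry_mem ν).1 (D.entry_ne_zero ν)
      (analyticOnNhd_comp_add (hu a t) _) (hu a t) (fun x => ?_) Ω
    rw [← hAvu, ← (D.entry_mem ν).2 x, ← hAvu]
    exact (hAv a t).2 x
  · ext a t
    simpa using hAvu a t Ω

end SingularValueOrbits

/-! ### Orthonormality of the singular vectors of all orbits -/

namespace SingularValueOrbits

variable {M N : ℕ} {A : ℂ → Matrix (Fin M) (Fin N) ℂ} (D : SingularValueOrbits A)

/-- The labels of the nonzero diagonal positions: an orbit, a member of the orbit and a copy. -/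
abbrev Label : Type := Σ ν : Fin D.R, Fin (D.k ν) × Fin (D.q ν)

/-- The squared Frobenius norm of `A` in terms of the nonzero analytic singular values. -/
lemma sum_norm_sq_eq_sum_sq (Ω : ℝ) :
    ∑ a, ∑ b, ‖A (Complex.exp (Complex.I * Ω)) a b‖ ^ 2 =
      ∑ y : D.Label, D.σ y.1 y.2.1 Ω ^ 2 := by
  classical
  set B := A (Complex.exp (Complex.I * Ω)) with hB
  have h1 : ((∑ a, ∑ b, ‖B a b‖ ^ 2 : ℝ) : ℂ) = (Bᴴ * B).trace := by
    rw [Finset.sum_comm]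
    simp only [Matrix.trace, Matrix.diag_apply, Matrix.mul_apply, Matrix.conjTranspose_apply,
      Complex.ofReal_sum]
    refine Finset.sum_congr rfl fun b _ => Finset.sum_congr rfl fun a _ => ?_
    rw [← Complex.normSq_eq_norm_sq, ← Complex.mul_conj, mul_comm, Complex.star_def]
  rw [trace_conjTranspose_mul_self_eq_sum, ← Complex.ofReal_sum] at h1
  rw [Complex.ofReal_inj.1 h1]
  obtain ⟨π, hπ⟩ := D.exists_perm_singularValues Ω
  rw [← Equiv.sum_comp π]
  simp only [← hB] at hπ
  simp only [← hπ, sq_abs]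
  have h2 : ∑ l, D.diag l Ω ^ 2 = ∑ l ∈ Finset.univ.map D.pos, D.diag l Ω ^ 2 := by
    refine (Finset.sum_subset (Finset.subset_univ _) fun l _ hl => ?_).symm
    rw [D.diag_zero l (fun ⟨y, hy⟩ => hl (Finset.mem_map.2 ⟨y, Finset.mem_univ _, hy⟩))]
    simp
  rw [h2, Finset.sum_map]
  refine Finset.sum_congr rfl fun y _ => ?_
  rw [D.diag_pos]

lemma norm_diag_pos (ν : Fin D.R) (i : Fin (D.k ν)) (Ω : ℝ) :
    ‖D.entry ν (Ω + 2 * Real.pi * (i : ℕ))‖ = |D.σ ν i Ω| := by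
  rw [norm_entry, ← D.σ_eq_shift ν i i.2]

lemma sq_sub_sq_ne_zero {ν μ : Fin D.R} {i : Fin (D.k ν)} {j : Fin (D.k μ)}
    (h : (⟨ν, i⟩ : Σ ν, Fin (D.k ν)) ≠ ⟨μ, j⟩) :
    ∃ Ω, ((D.σ ν i Ω ^ 2 - D.σ μ j Ω ^ 2 : ℝ) : ℂ) ≠ 0 := by
  by_contra! hall
  refine h (D.σ_distinct ⟨ν, i⟩ ⟨μ, j⟩ fun Ω => ?_)
  have h1 := hall Ω
  rw [Complex.ofReal_eq_zero, sub_eq_zero] at h1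
  exact (sq_eq_sq_iff_abs_eq_abs _ _).1 h1

/-- The analytic singular vectors of all orbits together: the vectors of the first member of each
orbit, shifted along the orbit, form orthonormal systems on both sides. Vectors of different
singular values are orthogonal wherever the singular values differ, hence everywhere. -/
lemma exists_singular_frames (hA : AnalyticOnCircle A) :
    ∃ (v : ∀ ν, ℝ → Matrix (Fin N) (Fin (D.q ν)) ℂ) (u : ∀ ν, ℝ → Matrix (Fin M) (Fin (D.q ν)) ℂ)
      (VF : ℝ → Matrix (Fin N) D.Label ℂ) (UF : ℝ → Matrix (Fin M) D.Label ℂ),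
      (∀ ν a b, (fun x => v ν x a b) ∈ analyticPeriodic (2 * Real.pi * D.k ν)) ∧
      (∀ ν a b, (fun x => u ν x a b) ∈ analyticPeriodic (2 * Real.pi * D.k ν)) ∧
      (∀ Ω a y, VF Ω a y = v y.1 (Ω + 2 * Real.pi * (y.2.1 : ℕ)) a y.2.2) ∧
      (∀ Ω a y, UF Ω a y = u y.1 (Ω + 2 * Real.pi * (y.2.1 : ℕ)) a y.2.2) ∧
      (∀ Ω, (VF Ω)ᴴ * VF Ω = 1) ∧ (∀ Ω, (UF Ω)ᴴ * UF Ω = 1) ∧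
      ∀ (Ω : ℝ) a y, (A (Complex.exp (Complex.I * Ω)) * VF Ω) a y =
        D.entry y.1 (Ω + 2 * Real.pi * (y.2.1 : ℕ)) * UF Ω a y := by
  classical
  choose v u hv hu hvv heig hAvu using D.exists_singular_vectors hA
  set VF : ℝ → Matrix (Fin N) D.Label ℂ := fun Ω => Matrix.of fun a y =>
    v y.1 (Ω + 2 * Real.pi * (y.2.1 : ℕ)) a y.2.2 with hVF
  set UF : ℝ → Matrix (Fin M) D.Label ℂ := fun Ω => Matrix.of fun a y =>
    u y.1 (Ω + 2 * Real.pi * (y.2.1 : ℕ)) a y.2.2 with hUF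
  have hVan : ∀ a y, AnalyticOnNhd ℝ (fun Ω => VF Ω a y) Set.univ := fun a y =>
    analyticOnNhd_comp_add (hv y.1 a y.2.2).1 _
  have hUan : ∀ a y, AnalyticOnNhd ℝ (fun Ω => UF Ω a y) Set.univ := fun a y =>
    analyticOnNhd_comp_add (hu y.1 a y.2.2).1 _
  have hstar : ∀ {f : ℝ → ℂ}, AnalyticOnNhd ℝ f Set.univ →
      AnalyticOnNhd ℝ (fun x => star (f x)) Set.univ := fun hf x hx =>
    (Complex.conjCLE.toContinuousLinearMap.analyticAt _).comp (hf x hx)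
  have hVVan : ∀ y z, AnalyticOnNhd ℝ (fun Ω => ((VF Ω)ᴴ * VF Ω) y z) Set.univ := fun y z x hx => by
    simp only [Matrix.mul_apply, Matrix.conjTranspose_apply]
    exact Finset.analyticAt_fun_sum _ fun a _ => (hstar (hVan a y) x hx).fun_mul (hVan a z x hx)
  have hUUan : ∀ y z, AnalyticOnNhd ℝ (fun Ω => ((UF Ω)ᴴ * UF Ω) y z) Set.univ := fun y z x hx => by
    simp only [Matrix.mul_apply, Matrix.conjTranspose_apply]
    exact Finset.analyticAt_fun_sum _ fun a _ => (hstar (hUan a y) x hx).fun_mul (hUan a z x hx)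
  have hAV : ∀ (Ω : ℝ) a y, (A (Complex.exp (Complex.I * Ω)) * VF Ω) a y =
        D.entry y.1 (Ω + 2 * Real.pi * (y.2.1 : ℕ)) * UF Ω a y := fun Ω a y => by
    have h1 := congrFun (congrFun (hAvu y.1 (Ω + 2 * Real.pi * (y.2.1 : ℕ))) a) y.2.2
    rw [circle_periodic A] at h1
    exact h1
  have hEV : ∀ Ω : ℝ, (A (Complex.exp (Complex.I * Ω)))ᴴ * A (Complex.exp (Complex.I * Ω)) * VF Ω =
      VF Ω * Matrix.diagonal fun y : D.Label => ((D.σ y.1 y.2.1 Ω ^ 2 : ℝ) : ℂ) := fun Ω => by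
    ext a y
    have h1 := congrFun (congrFun (heig y.1 (Ω + 2 * Real.pi * (y.2.1 : ℕ))) a) y.2.2
    rw [circle_periodic A, ← D.σ_eq_shift y.1 y.2.1 y.2.1.2] at h1
    rw [Matrix.mul_diagonal]
    exact h1.trans (mul_comm _ _)
  have hVV : ∀ Ω, (VF Ω)ᴴ * VF Ω = 1 := by
    intro Ω
    ext y z
    obtain ⟨ν, i, t⟩ := y
    obtain ⟨μ, j, s⟩ := z
    by_cases hyz : (⟨ν, i⟩ : Σ ν, Fin (D.k ν)) = ⟨μ, j⟩
    · cases hyz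
      have h1 := congrFun (congrFun (hvv ν (Ω + 2 * Real.pi * (i : ℕ))) t) s
      have h2 : (1 : Matrix D.Label D.Label ℂ) ⟨ν, i, t⟩ ⟨ν, i, s⟩ =
          (1 : Matrix (Fin (D.q ν)) (Fin (D.q ν)) ℂ) t s := by
        simp [Matrix.one_apply]
      rw [h2, ← h1]
      rfl
    · have hne : (⟨ν, i, t⟩ : D.Label) ≠ ⟨μ, j, s⟩ := fun h => by
        cases h
        exact hyz rfl
      rw [Matrix.one_apply_ne hne]
      -- both sides of `⟨Aᴴ A v, w⟩ = ⟨v, Aᴴ A w⟩` are multiples of `⟨v, w⟩`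
      refine mul_left_cancel_of_analytic
        (f := fun Ω => ((D.σ ν i Ω ^ 2 - D.σ μ j Ω ^ 2 : ℝ) : ℂ)) (v := fun _ => 0)
        (fun x hx => (Complex.ofRealCLM.analyticAt _).comp
          (((D.σ_analytic ν i x hx).pow 2).sub ((D.σ_analytic μ j x hx).pow 2)))
        (D.sq_sub_sq_ne_zero hyz) (hVVan ⟨ν, i, t⟩ ⟨μ, j, s⟩) (fun _ _ => analyticAt_const)
        (fun x => ?_) Ω
      set B := A (Complex.exp (Complex.I * x))
      have h1 : (VF x)ᴴ * (Bᴴ * B * VF x) = (VF x)ᴴ * VF x *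
          Matrix.diagonal fun y : D.Label => ((D.σ y.1 y.2.1 x ^ 2 : ℝ) : ℂ) := by
        rw [hEV, Matrix.mul_assoc]
      have h2 : (Bᴴ * B * VF x)ᴴ * VF x = (VF x)ᴴ * (Bᴴ * B * VF x) := by
        simp only [Matrix.conjTranspose_mul, Matrix.conjTranspose_conjTranspose, Matrix.mul_assoc]
      have h3 : (Bᴴ * B * VF x)ᴴ * VF x =
          (Matrix.diagonal fun y : D.Label => ((D.σ y.1 y.2.1 x ^ 2 : ℝ) : ℂ)) *
            ((VF x)ᴴ * VF x) := by
        rw [hEV, Matrix.conjTranspose_mul, Matrix.mul_assoc, Matrix.diagonal_conjTranspose]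
        congr 2
        funext y
        simp
      have h4 := congrFun (congrFun (h3.symm.trans (h2.trans h1)) ⟨ν, i, t⟩) ⟨μ, j, s⟩
      rw [Matrix.diagonal_mul, Matrix.mul_diagonal] at h4
      push_cast at h4 ⊢
      linear_combination h4
  -- on the left, `(A V)ᴴ A V = Σ²` is divided by products of two diagonal entries, whose zeros
  -- are isolated
  refine ⟨v, u, VF, UF, hv, hu, fun _ _ _ => rfl, fun _ _ _ => rfl, hVV, fun Ω => ?_, hAV⟩
  ext y z
  set e : D.Label → ℝ → ℂ := fun y Ω => D.entry y.1 (Ω + 2 * Real.pi * (y.2.1 : ℕ)) with he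
  have hean : ∀ y, AnalyticOnNhd ℝ (e y) Set.univ := fun y =>
    analyticOnNhd_comp_add (D.entry_mem y.1).1 _
  have he0 : ∀ y, ∃ Ω, e y Ω ≠ 0 := fun y => by
    obtain ⟨Ω, hΩ⟩ := D.entry_ne_zero y.1
    exact ⟨Ω - 2 * Real.pi * (y.2.1 : ℕ), by simpa [he] using hΩ⟩
  refine mul_left_cancel_of_analytic (f := fun Ω => star (e y Ω) * e z Ω)
    (v := fun _ => (1 : Matrix D.Label D.Label ℂ) y z)
    (fun x hx => (hstar (hean y) x hx).fun_mul (hean z x hx)) ?_ (hUUan y z)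
    (fun _ _ => analyticAt_const) (fun x => ?_) Ω
  · obtain ⟨x, h1, h2⟩ := ((eventually_ne_zero_of_analytic (hean y) (he0 y) 0).and
      (eventually_ne_zero_of_analytic (hean z) (he0 z) 0)).exists
    exact ⟨x, mul_ne_zero (star_ne_zero.2 h1) h2⟩
  · set B := A (Complex.exp (Complex.I * x))
    have h1 : (B * VF x)ᴴ * (B * VF x) =
        Matrix.diagonal fun y : D.Label => ((D.σ y.1 y.2.1 x ^ 2 : ℝ) : ℂ) := by
      rw [Matrix.conjTranspose_mul, Matrix.mul_assoc, ← Matrix.mul_assoc _ _ (VF x), hEV,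
        ← Matrix.mul_assoc, hVV, Matrix.one_mul]
    have h2 := congrFun (congrFun h1 y) z
    simp only [Matrix.mul_apply (M := (B * VF x)ᴴ), Matrix.conjTranspose_apply, B, hAV] at h2
    have h3 : star (e y x) * e z x * ((UF x)ᴴ * UF x) y z = (Matrix.diagonal
        fun y : D.Label => ((D.σ y.1 y.2.1 x ^ 2 : ℝ) : ℂ)) y z := by
      rw [← h2, Matrix.mul_apply, Finset.mul_sum]
      refine Finset.sum_congr rfl fun a _ => ?_
      rw [Matrix.conjTranspose_apply, star_mul']
      ring
    rw [h3]
    rcases eq_or_ne y z with rfl | hyz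
    · rw [Matrix.diagonal_apply_eq, Matrix.one_apply_eq, mul_one, mul_comm, Complex.star_def,
        Complex.mul_conj, Complex.normSq_eq_norm_sq, he, D.norm_diag_pos, sq_abs]
    · rw [Matrix.diagonal_apply_ne _ hyz, Matrix.one_apply_ne hyz, mul_zero]

end SingularValueOrbits

/-! ### The factorization -/

lemma diagRow_injective {M N : ℕ} : Function.Injective (diagRow (M := M) (N := N)) :=
  Fin.castLE_injective (min_le_left M N)

lemma diagCol_injective {M N : ℕ} : Function.Injective (diagCol (M := M) (N := N)) :=
  Fin.castLE_injective (min_le_right M N)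

/-- If `W` is unitary and some columns of `B W` already have the Frobenius norm of `B`, all other
columns of `B W` are zero. -/
lemma mul_apply_eq_zero_of_frobenius {M N : ℕ} {ι : Type*} [Fintype ι] {B : Matrix (Fin M) (Fin N) ℂ}
    {W : Matrix (Fin N) (Fin N) ℂ} (hW : Wᴴ * W = 1) (e : ι ↪ Fin N)
    (hs : ∑ a, ∑ b, ‖B a b‖ ^ 2 = ∑ y, ∑ a, ‖(B * W) a (e y)‖ ^ 2) {b : Fin N}
    (hb : b ∉ Set.range e) (a : Fin M) : (B * W) a b = 0 := by
  classical
  have hfrob : ∀ C : Matrix (Fin M) (Fin N) ℂ,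
      ((∑ b, ∑ a, ‖C a b‖ ^ 2 : ℝ) : ℂ) = (C * Cᴴ).trace := fun C => by
    rw [Finset.sum_comm]
    simp only [Matrix.trace, Matrix.diag_apply, Matrix.mul_apply, Matrix.conjTranspose_apply,
      Complex.ofReal_sum]
    refine Finset.sum_congr rfl fun b _ => Finset.sum_congr rfl fun a _ => ?_
    rw [← Complex.normSq_eq_norm_sq, ← Complex.mul_conj, Complex.star_def]
  have h1 : ∑ b, ∑ a, ‖(B * W) a b‖ ^ 2 = ∑ b, ∑ a, ‖B a b‖ ^ 2 := by
    apply Complex.ofReal_injective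
    rw [hfrob, hfrob, Matrix.conjTranspose_mul, Matrix.mul_assoc, ← Matrix.mul_assoc W,
      mul_eq_one_comm.1 hW, Matrix.one_mul]
  have h2 := Finset.sum_add_sum_compl (Finset.univ.map e) fun b => ∑ a, ‖(B * W) a b‖ ^ 2
  have h2' : ∑ b, ∑ a, ‖(B * W) a b‖ ^ 2 = ∑ y, ∑ a, ‖(B * W) a (e y)‖ ^ 2 := by
    rw [h1, Finset.sum_comm, hs]
  rw [h2', Finset.sum_map, add_eq_left] at h2
  have h3 := (Finset.sum_eq_zero_iff_of_nonneg fun b _ =>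
    Finset.sum_nonneg fun a _ => by positivity).1 h2 b (by simpa using hb)
  have h4 := (Finset.sum_eq_zero_iff_of_nonneg fun a _ => by positivity).1 h3 a
    (Finset.mem_univ a)
  simpa using h4

theorem theorem3 {M N : ℕ} (A : ℂ → Matrix (Fin M) (Fin N) ℂ) (hA : AnalyticOnCircle A) :
    -- analytic singular values exist and split into (signed) multiplexed orbits
    Nonempty (SingularValueOrbits A) ∧
    -- for all analytic singular values, arranged in any way into such orbits:
    ∀ D : SingularValueOrbits A,
      ∃ (L : ℕ) (Uz : ℂ → Matrix (Fin M) (Fin M) ℂ) (Sz : ℂ → Matrix (Fin M) (Fin N) ℂ)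
        (Vz : ℂ → Matrix (Fin N) (Fin N) ℂ)
        (U : ℝ → Matrix (Fin M) (Fin M) ℂ) (S : ℝ → Matrix (Fin M) (Fin N) ℂ)
        (V : ℝ → Matrix (Fin N) (Fin N) ℂ),
        0 < L ∧ IsParaunitary Uz ∧ AnalyticOnCircle Sz ∧ IsParaunitary Vz ∧
        U = onAngle L Uz ∧ S = onAngle L Sz ∧ V = onAngle L Vz ∧
        -- the factorization, with a diagonal middle factor
        (∀ Ω : ℝ, A (Complex.exp (Complex.I * Ω)) = U Ω * S Ω * (V Ω).conjTranspose) ∧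
        (∀ (Ω : ℝ) (a : Fin M) (b : Fin N), (a : ℕ) ≠ (b : ℕ) → S Ω a b = 0) ∧
        -- the absolute values of the diagonal entries are the singular values
        (∀ Ω : ℝ, (Finset.univ : Finset (Fin (min M N))).val.map (fun l => ‖diagEntry S l Ω‖) =
          singularValueMultiset (A (Complex.exp (Complex.I * Ω)))) ∧
        -- the diagonal entries are the analytic singular values times the phase factors
        (∀ l, l ∉ Set.range D.pos → ∀ Ω, diagEntry S l Ω = 0) ∧
        (∀ ν i t Ω, diagEntry S (D.pos ⟨ν, i, t⟩) Ω =
          (D.σ ν i Ω : ℂ) * phase (D.k ν * D.κ ν) (i : ℕ) Ω) ∧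
        -- entries, left and right singular vectors are multiplexed without sign, and periodic
        (∀ ν, (∀ t, IsMultiplexed (D.k ν) (fun i => diagEntry S (D.pos ⟨ν, i, t⟩))) ∧
          IsMultiplexed (D.k ν) (D.leftVectors U ν) ∧
          IsMultiplexed (D.k ν) (D.rightVectors V ν)) ∧
        (∀ ν i, (∀ t, Function.Periodic (diagEntry S (D.pos ⟨ν, i, t⟩)) (2 * Real.pi * D.k ν)) ∧
          Function.Periodic (D.leftVectors U ν i) (2 * Real.pi * D.k ν) ∧
          Function.Periodic (D.rightVectors V ν i) (2 * Real.pi * D.k ν)) := by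
  classical
  refine ⟨nonempty_singularValueOrbits A hA, fun D => ?_⟩
  obtain ⟨v, u, VF, UF, hv, hu, hVF, hUF, hVV, hUU, hAV⟩ := D.exists_singular_frames hA
  -- a common multiple of the orbit lengths
  set L : ℕ := ∏ ν, D.k ν with hLdef
  have hL : 0 < L := Finset.prod_pos fun ν _ => D.k_pos ν
  have hT : 2 * Real.pi * L ≠ 0 := by positivity
  have hmono : ∀ {ν : Fin D.R} {f : ℝ → ℂ}, f ∈ analyticPeriodic (2 * Real.pi * D.k ν) →
      f ∈ analyticPeriodic (2 * Real.pi * L) := fun {ν} {f} hf => by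
    obtain ⟨n, hn⟩ := Finset.dvd_prod_of_mem D.k (Finset.mem_univ ν)
    rw [hLdef, hn, Nat.cast_mul, ← mul_assoc]
    exact analyticPeriodic.mul_nat_mem hf n
  have hVFmem : ∀ a y, (fun Ω => VF Ω a y) ∈ analyticPeriodic (2 * Real.pi * L) := fun a y => by
    simp only [hVF]
    exact hmono (analyticPeriodic.shift_mem (hv y.1 a y.2.2) _)
  have hUFmem : ∀ a y, (fun Ω => UF Ω a y) ∈ analyticPeriodic (2 * Real.pi * L) := fun a y => by
    simp only [hUF]
    exact hmono (analyticPeriodic.shift_mem (hu y.1 a y.2.2) _)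
  set eV : D.Label ↪ Fin N := D.pos.trans ⟨diagCol, diagCol_injective⟩
  set eU : D.Label ↪ Fin M := D.pos.trans ⟨diagRow, diagRow_injective⟩
  obtain ⟨V, hVmem, hVu, hVcol⟩ := analyticPeriodic.exists_unitary_completion hT hVFmem hVV eV
  obtain ⟨U, hUmem, hUu, hUcol⟩ := analyticPeriodic.exists_unitary_completion hT hUFmem hUU eU
  set S : ℝ → Matrix (Fin M) (Fin N) ℂ := fun Ω =>
    (U Ω)ᴴ * A (Complex.exp (Complex.I * Ω)) * V Ω with hS
  have hSmem : ∀ a b, (fun Ω => S Ω a b) ∈ analyticPeriodic (2 * Real.pi * L) := fun a b => by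
    simp only [hS, Matrix.mul_apply, Matrix.conjTranspose_apply]
    exact analyticPeriodic.sum_mem _ fun c _ => analyticPeriodic.mul_mem
      (analyticPeriodic.sum_mem _ fun d _ => analyticPeriodic.mul_mem
        (analyticPeriodic.star_mem (hUmem d a))
        (analyticPeriodic.mul_nat_mem (circle_mem_analyticPeriodic hA d c) L)) (hVmem c b)
  -- each nonzero singular value contributes one column of `A V`, a multiple of a column of `U`
  have hAVcol : ∀ (Ω : ℝ) a y, (A (Complex.exp (Complex.I * Ω)) * V Ω) a (eV y) =
      D.entry y.1 (Ω + 2 * Real.pi * (y.2.1 : ℕ)) * U Ω a (eU y) := fun Ω a y => by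
    rw [hUcol, ← hAV, Matrix.mul_apply, Matrix.mul_apply]
    exact Finset.sum_congr rfl fun b _ => by rw [hVcol]
  have hUorth : ∀ Ω a b, ∑ c, star (U Ω c a) * U Ω c b = (1 : Matrix (Fin M) (Fin M) ℂ) a b :=
    fun Ω a b => by
      rw [← hUu Ω, Matrix.mul_apply]
      rfl
  have hAVzero : ∀ (Ω : ℝ) b, b ∉ Set.range eV → ∀ a,
      (A (Complex.exp (Complex.I * Ω)) * V Ω) a b = 0 := fun Ω b hb a => by
    -- the columns at the positions of the nonzero singular values have the Frobenius norm of `A`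
    refine mul_apply_eq_zero_of_frobenius (hVu Ω) eV ?_ hb a
    rw [D.sum_norm_sq_eq_sum_sq]
    refine Finset.sum_congr rfl fun y _ => ?_
    simp only [hAVcol, norm_mul, mul_pow, D.norm_diag_pos, sq_abs, ← Finset.mul_sum]
    have h1 : ((∑ a, ‖U Ω a (eU y)‖ ^ 2 : ℝ) : ℂ) = 1 := by
      have h2 := hUorth Ω (eU y) (eU y)
      rw [Matrix.one_apply_eq] at h2
      rw [← h2, Complex.ofReal_sum]
      refine Finset.sum_congr rfl fun c _ => ?_
      rw [← Complex.normSq_eq_norm_sq, ← Complex.mul_conj, mul_comm, Complex.star_def]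
    rw [Complex.ofReal_eq_one.1 h1, mul_one]
  have hScol : ∀ (Ω : ℝ) a y, S Ω a (eV y) =
      D.entry y.1 (Ω + 2 * Real.pi * (y.2.1 : ℕ)) * (1 : Matrix (Fin M) (Fin M) ℂ) a (eU y) :=
    fun Ω a y => by
      rw [← hUorth Ω, hS]
      simp only
      rw [Matrix.mul_assoc, Matrix.mul_apply, Finset.mul_sum]
      refine Finset.sum_congr rfl fun c _ => ?_
      rw [hAVcol, Matrix.conjTranspose_apply]
      ring
  have hSzero : ∀ Ω a b, b ∉ Set.range eV → S Ω a b = 0 := fun Ω a b hb => by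
    rw [hS]
    simp only
    rw [Matrix.mul_assoc, Matrix.mul_apply]
    exact Finset.sum_eq_zero fun c _ => by rw [hAVzero Ω b hb, mul_zero]
  have hdiag : ∀ y : D.Label, ∀ Ω, diagEntry S (D.pos y) Ω =
      D.entry y.1 (Ω + 2 * Real.pi * (y.2.1 : ℕ)) := fun y Ω => by
    have h1 := hScol Ω (eU y) y
    rw [Matrix.one_apply_eq, mul_one] at h1
    exact h1
  have hdiag0 : ∀ l, l ∉ Set.range D.pos → ∀ Ω, diagEntry S l Ω = 0 := fun l hl Ω => by
    refine hSzero Ω _ _ ?_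
    rintro ⟨y, hy⟩
    exact hl ⟨y, diagCol_injective hy⟩
  obtain ⟨Uz, hUz, hUzU⟩ := exists_circle_extension_matrix hL hUmem
  obtain ⟨Vz, hVz, hVzV⟩ := exists_circle_extension_matrix hL hVmem
  obtain ⟨Sz, hSz, hSzS⟩ := exists_circle_extension_matrix hL hSmem
  have hleft : ∀ ν (i : Fin (D.k ν)) Ω, D.leftVectors U ν i Ω =
      u ν (Ω + 2 * Real.pi * (i : ℕ)) := fun ν i Ω => by
    ext a t
    exact (hUcol Ω a ⟨ν, i, t⟩).trans (hUF Ω a ⟨ν, i, t⟩)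
  have hright : ∀ ν (i : Fin (D.k ν)) Ω, D.rightVectors V ν i Ω =
      v ν (Ω + 2 * Real.pi * (i : ℕ)) := fun ν i Ω => by
    ext a t
    exact (hVcol Ω a ⟨ν, i, t⟩).trans (hVF Ω a ⟨ν, i, t⟩)
  have hup : ∀ ν, Function.Periodic (u ν) (2 * Real.pi * D.k ν) := fun ν Ω => by
    ext a t
    exact (hu ν a t).2 Ω
  have hvp : ∀ ν, Function.Periodic (v ν) (2 * Real.pi * D.k ν) := fun ν Ω => by
    ext a t
    exact (hv ν a t).2 Ω
  refine ⟨L, Uz, Sz, Vz, U, S, V, hL,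
    isParaunitary_of_unitary hL hUz fun Ω => hUzU ▸ mul_eq_one_comm.1 (hUu Ω), hSz,
    isParaunitary_of_unitary hL hVz fun Ω => hVzV ▸ mul_eq_one_comm.1 (hVu Ω), hUzU, hSzS, hVzV,
    fun Ω => ?_, fun Ω a b hab => ?_, fun Ω => ?_, hdiag0, fun ν i t Ω => ?_, fun ν => ⟨fun t => ?_,
    isMultiplexed_of_shift (hup ν) (hleft ν), isMultiplexed_of_shift (hvp ν) (hright ν)⟩,
    fun ν i => ⟨fun t => ?_, periodic_of_shift (hup ν) (hleft ν) i,
      periodic_of_shift (hvp ν) (hright ν) i⟩⟩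
  · rw [hS]
    simp only
    rw [← Matrix.mul_assoc, ← Matrix.mul_assoc, mul_eq_one_comm.1 (hUu Ω), Matrix.one_mul,
      Matrix.mul_assoc, mul_eq_one_comm.1 (hVu Ω), Matrix.mul_one]
  · by_cases hb : b ∈ Set.range eV
    · obtain ⟨y, rfl⟩ := hb
      rw [hScol, Matrix.one_apply_ne (fun h => hab (by rw [h]; rfl)), mul_zero]
    · exact hSzero Ω a b hb
  · rw [← D.abs_diag]
    refine Multiset.map_congr rfl fun l _ => ?_
    by_cases hl : l ∈ Set.range D.pos
    · obtain ⟨⟨ν, i, t⟩, rfl⟩ := hl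
      rw [hdiag, D.norm_diag_pos, D.diag_pos]
    · rw [hdiag0 l hl, D.diag_zero l hl, norm_zero, abs_zero]
  · rw [hdiag, D.entry_shift]
  · exact isMultiplexed_of_shift (D.entry_mem ν).2 fun i Ω => hdiag ⟨ν, i, t⟩ Ω
  · exact periodic_of_shift (f := fun i => diagEntry S (D.pos ⟨ν, i, t⟩)) (D.entry_mem ν).2
      (fun i Ω => hdiag ⟨ν, i, t⟩ Ω) i
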